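/- Let $\mathcal S\subseteq\{-1,0,1\}^2\setminus\{(0,0)\}$ be one of the following 19 step sets (written with compass directions $N=(0,1)$, $E=(1,0)$, $S=(0,-1)$, $W=(-1,0)$, $NE=(1,1)$, etc.), or the image of one of them under the exchange of coordinates $(i,j)\mapsto(j,i)$: $\{N,S,E,W\}$, $\{NE,SE,NW,SW\}$, $\{N,S,NE,SE,NW,SW\}$, $\{N,S,E,W,NW,SW,SE,NE\}$, $\{NE,NW,S\}$, $\{N,NW,NE,S\}$, $\{NE,NW,E,W,S\}$, $\{N,NE,NW,SE,SW\}$, $\{N,NW,NE,E,W,S\}$, $\{N,E,W,NE,NW,SE,SW\}$, $\{N,SE,SW\}$, $\{N,S,SE,SW\}$, $\{N,E,W,SE,SW\}$, $\{NE,NW,SE,SW,S\}$, $\{N,E,W,S,SW,SE\}$, $\{NE,NW,E,W,SE,SW,S\}$, $\{N,W,SE\}$, $\{NW,SE,N,S,E,W\}$, $\{E,SE,W,NW\}$. Let $C(x,y,t)=\sum_{i,j,n\ge 0}c_{i,j,n}x^iy^jt^n$, where $c_{i,j,n}$ is the number of walks of length $n$ with steps in $\mathcal S$ that start at the origin, end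 at $(i,j)$ and never leave the quadrant $\{(i,j): i,j\ge 0\}$. Write $\bar x=1/x$, $\bar y=1/y$, and $$S(x,y)=\sum_{(i,j)\in\mathcal S}x^iy^j=\sum_{k=-1}^{1}A_k(x)\,y^k=\sum_{k=-1}^{1}B_k(y)\,x^k .$$ Let $\mathcal G$ be the group of birational transformations of the plane generated by the involutions $$\Phi:(x,y)\mapsto\Bigl(x,\ \bar y\,\frac{A_{-1}(x)}{A_1(x)}\Bigr),\qquad \Psi:(x,y)\mapsto\Bigl(\bar x\,\frac{B_{-1}(y)}{B_1(y)},\ y\Bigr),$$ let $g(f)=f\circ g$ for $g\in\mathcal G$ and a rational function $f$, let $\operatorname{sgn}(g)=(-1)^{\ell(g)}$, where $\ell(g)$ is the minimal length of $g$ as a word in $\Phi$ and $\Psi$, and let $O(x,y)=\sum_{g\in\mathcal G}\operatorname{sgn}(g)\,g(xy)$. Then $\mathcal G$ is finite, and for all $a,b\in\{0,1\}$ $$C(a,b,t)=\Delta\left(\frac{xy\,O(\bar x,\bar y)}{1-txy\,S(\bar x,\bar y)}\cdot(1-x)^{-a}(1-y)^{-b}\right).$$ Here the rational function is expanded as a power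 series in $t$ whose coefficients are Laurent series in $y$ over the field of Laurent series in $x$, that is, in $\mathbb Q((x))((y))[[t]]$, and $\Delta$ is the diagonal operator $\Delta\bigl(\sum_{n\ge0}\bigl(\sum_{i,j}r_{i,j,n}x^iy^j\bigr)t^n\bigr)=\sum_{n\ge0}r_{n,n,n}t^n$. -/

import Mathlib

namespace QuadrantWalk

noncomputable section

/-! ### The step sets -/

abbrev stepN : ℤ × ℤ := (0, 1)
abbrev stepS : ℤ × ℤ := (0, -1)
abbrev stepE : ℤ × ℤ := (1, 0)
abbrev stepW : ℤ × ℤ := (-1, 0)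
abbrev stepNE : ℤ × ℤ := (1, 1)
abbrev stepNW : ℤ × ℤ := (-1, 1)
abbrev stepSE : ℤ × ℤ := (1, -1)
abbrev stepSW : ℤ × ℤ := (-1, -1)

/-- The 19 non-algebraic quadrant models with finite group. -/
def nonalgebraicModels : Finset (Finset (ℤ × ℤ)) :=
  { -- symmetric over both axes
    {stepN, stepS, stepE, stepW},
    {stepNE, stepSE, stepNW, stepSW},
    {stepN, stepS, stepNE, stepSE, stepNW, stepSW},
    {stepN, stepS, stepE, stepW, stepNW, stepSW, stepSE, stepNE},
    -- symmetric over the vertical axis, positive drift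
    {stepNE, stepNW, stepS},
    {stepN, stepNW, stepNE, stepS},
    {stepNE, stepNW, stepE, stepW, stepS},
    {stepN, stepNE, stepNW, stepSE, stepSW},
    {stepN, stepNW, stepNE, stepE, stepW, stepS},
    {stepN, stepE, stepW, stepNE, stepNW, stepSE, stepSW},
    -- symmetric over the vertical axis, negative drift
    {stepN, stepSE, stepSW},
    {stepN, stepS, stepSE, stepSW},
    {stepN, stepE, stepW, stepSE, stepSW},
    {stepNE, stepNW, stepSE, stepSW, stepS},
    {stepN, stepE, stepW, stepS, stepSW, stepSE},
    {stepNE, stepNW, stepE, stepW, stepSE, stepSW, stepS},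
    -- sporadic
    {stepN, stepW, stepSE},
    {stepNW, stepSE, stepN, stepS, stepE, stepW},
    {stepE, stepSE, stepW, stepNW} }

/-! ### Walks in the quadrant and their generating function -/

/-- The position after the first `k` steps of `w`, starting from the origin. -/
def position {n : ℕ} (w : Fin n → ℤ × ℤ) (k : ℕ) : ℤ × ℤ :=
  ∑ m : Fin n, if (m : ℕ) < k then w m else 0

/-- The walks of length `n` on the steps `S` that start at the origin and never leave the
quadrant `{(i, j) | 0 ≤ i, 0 ≤ j}`. -/
def quadrantWalks (S : Finset (ℤ × ℤ)) (n : ℕ) : Finset (Fin n → ℤ × ℤ) :=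
  {w ∈ Fintype.piFinset fun _ : Fin n => S |
    ∀ k : Fin (n + 1), 0 ≤ (position w k).1 ∧ 0 ≤ (position w k).2}

/-- `c_{i,j,n}`: the number of those walks that end at `(i, j)`. -/
def walkCount (S : Finset (ℤ × ℤ)) (i j n : ℕ) : ℕ :=
  {w ∈ quadrantWalks S n | position w n = ((i : ℤ), (j : ℤ))}.card

/-- `C(x, y, t) = ∑ c_{i,j,n} x^i y^j t^n`, as an element of `ℚ[x, y][[t]]`. For steps in
`{-1, 0, 1}²` a walk of length `n` ends at a point with both coordinates at most `n`. -/
def walkGF (S : Finset (ℤ × ℤ)) : PowerSeries (MvPolynomial (Fin 2) ℚ) :=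
  PowerSeries.mk fun n =>
    ∑ i ∈ Finset.range (n + 1), ∑ j ∈ Finset.range (n + 1),
      (walkCount S i j n : MvPolynomial (Fin 2) ℚ) *
        (MvPolynomial.X 0 ^ i * MvPolynomial.X 1 ^ j)

/-- `C(a, b, t) ∈ ℚ[[t]]`. -/
def walkGFAt (S : Finset (ℤ × ℤ)) (a b : ℚ) : PowerSeries ℚ :=
  PowerSeries.map (MvPolynomial.eval ![a, b]) (walkGF S)

/-! ### The group of a model and the orbit sum -/

/-- The field `ℚ(x, y)`. -/
abbrev RatXY : Type := FractionRing (MvPolynomial (Fin 2) ℚ)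

/-- The element `x` of `ℚ(x, y)`. -/
def rx : RatXY := algebraMap (MvPolynomial (Fin 2) ℚ) RatXY (MvPolynomial.X 0)

/-- The element `y` of `ℚ(x, y)`. -/
def ry : RatXY := algebraMap (MvPolynomial (Fin 2) ℚ) RatXY (MvPolynomial.X 1)

/-- The value `f(u, v)` of a rational function `f` at elements `u, v` of a field, from a
representation of `f` in lowest terms. -/
def ratEval {F : Type*} [Field F] [Algebra ℚ F] (f : RatXY) (u v : F) : F :=
  MvPolynomial.aeval ![u, v] (IsFractionRing.num (MvPolynomial (Fin 2) ℚ) f) /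
    MvPolynomial.aeval ![u, v]
      (IsFractionRing.den (MvPolynomial (Fin 2) ℚ) f : MvPolynomial (Fin 2) ℚ)

/-- The characteristic polynomial `S(u, v) = ∑_{(i, j) ∈ S} u^i v^j`. -/
def stepPoly {F : Type*} [Field F] (S : Finset (ℤ × ℤ)) (u v : F) : F :=
  ∑ p ∈ S, u ^ p.1 * v ^ p.2

/-- `A_k(u) = [y^k] S(u, y)`. -/
def coeffA {F : Type*} [Field F] (S : Finset (ℤ × ℤ)) (k : ℤ) (u : F) : F :=
  ∑ p ∈ S with p.2 = k, u ^ p.1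

/-- `B_k(v) = [x^k] S(x, v)`. -/
def coeffB {F : Type*} [Field F] (S : Finset (ℤ × ℤ)) (k : ℤ) (v : F) : F :=
  ∑ p ∈ S with p.1 = k, v ^ p.2

/-- A birational transformation `(x, y) ↦ (u, v)` of the plane over `ℚ`, given by its action
`f(x, y) ↦ f(u, v)` on `ℚ(x, y)`, which is an automorphism over `ℚ`. -/
abbrev Birational : Type := RatXY ≃ₐ[ℚ] RatXY

/-- `σ` is the transformation `Φ : (x, y) ↦ (x, y⁻¹ A₋₁(x) / A₁(x))`. -/
def IsPhi (S : Finset (ℤ × ℤ)) (σ : Birational) : Prop :=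
  σ rx = rx ∧ σ ry = ry⁻¹ * (coeffA S (-1) rx / coeffA S 1 rx)

/-- `σ` is the transformation `Ψ : (x, y) ↦ (x⁻¹ B₋₁(y) / B₁(y), y)`. -/
def IsPsi (S : Finset (ℤ × ℤ)) (σ : Birational) : Prop :=
  σ rx = rx⁻¹ * (coeffB S (-1) ry / coeffB S 1 ry) ∧ σ ry = ry

/-- The two generators `Φ` and `Ψ`, which are involutions. -/
def generators (S : Finset (ℤ × ℤ)) : Set Birational :=
  {σ | IsPhi S σ ∨ IsPsi S σ}

/-- The group of the model. -/
def modelGroup (S : Finset (ℤ × ℤ)) : Subgroup Birational :=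
  Subgroup.closure (generators S)

/-- The minimal length of a word in `Φ` and `Ψ` that represents `g`. -/
def wordLength (S : Finset (ℤ × ℤ)) (g : Birational) : ℕ :=
  sInf {m | ∃ l : List Birational, (∀ σ ∈ l, σ ∈ generators S) ∧ l.prod = g ∧ l.length = m}

/-- The orbit sum `O(x, y) = ∑_{g} sgn(g) g(xy)`, where `sgn(g) = (-1)^{length of g}`. -/
def orbitSum (S : Finset (ℤ × ℤ)) : RatXY :=
  ∑ᶠ g : modelGroup S, (-1 : RatXY) ^ wordLength S (g : Birational) *
    (g : Birational) (rx * ry)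

/-! ### Series expansions and the diagonal -/

/-- The field of iterated Laurent series `ℚ((x))((y))`. -/
abbrev LaurentXY : Type := LaurentSeries (LaurentSeries ℚ)

/-- The element `x` of `ℚ((x))((y))`. -/
def lx : LaurentXY := HahnSeries.single 0 (HahnSeries.single 1 1)

/-- The element `y` of `ℚ((x))((y))`. -/
def ly : LaurentXY := HahnSeries.single 1 1

/-- The diagonal `∑_n (∑_{i,j} r_{i,j,n} x^i y^j) t^n ↦ ∑_n r_{n,n,n} t^n`, on series in `t`
whose coefficients are Laurent series in `x` and `y`. -/
def diagonal (f : PowerSeries LaurentXY) : PowerSeries ℚ :=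
  PowerSeries.mk fun n => ((PowerSeries.coeff n f).coeff (n : ℤ)).coeff (n : ℤ)

/-- The series
`xy O(x⁻¹, y⁻¹) / (1 - txy S(x⁻¹, y⁻¹)) * (1 - x)^(-a) * (1 - y)^(-b)`, expanded in
`ℚ((x))((y))[[t]]`. -/
def diagonand (S : Finset (ℤ × ℤ)) (a b : ℕ) : PowerSeries LaurentXY :=
  PowerSeries.C (lx * ly * ratEval (orbitSum S) lx⁻¹ ly⁻¹) *
    (1 - PowerSeries.X * PowerSeries.C (lx * ly * stepPoly S lx⁻¹ ly⁻¹))⁻¹ *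
    PowerSeries.C ((1 - lx) ^ (-(a : ℤ)) * (1 - ly) ^ (-(b : ℤ)))

end

end QuadrantWalk

namespace QuadrantWalk

open MvPolynomial

/-! ### Birational transformations of the plane -/

/-! This is the reflection principle, read off from the orbit sum. For p = (i, j) let f(n, p) be the
coefficient of x^(-i) y^(-j) in xy O(x⁻¹, y⁻¹) S(x⁻¹, y⁻¹)^n. Each factor S(x⁻¹, y⁻¹) adds one step,
so f obeys the recursion of walks in the whole plane. If f(0, ·) is the indicator of the origin on
the quadrant, and f vanishes on the adjacent lines i = -1 and j = -1, then f counts quadrant walks: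
small steps cannot jump over these lines (`eq_endCount_of_recursion`).

The vanishing comes from antisymmetry. The generators Φ and Ψ fix S and change the sign of O; on
coefficients they act, up to a weight, as reflections that fix the two lines, so f equals its own
negative there. Two cases make this precise.

If the steps are symmetric in one axis, the group is a Klein four-group and O factors, but it may
have denominators. In the direction across the other axis, f is a three-term recursion over a field
of Laurent series, and `reflection_of_recursion` applies. The second reflection is used only on the
half plane bounded by the line where f already vanishes: there the initial values are finite and
symmetric, whereas the expanded denominators below need not be (`IsCoeffFamily.eq_endCount`). In the
three sporadic models Φ and Ψ map monomials to monomials, O is a Laurent polynomial, and both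
reflections work on the whole plane (`orbitSumCountsWalks_of_monomial`).

The group is dihedral in all cases, so the signs in O are determined by parity
(`orbitSum_of_involutions`). Finally, the diagonal extracts a constant term. The factors (1 -
x)^(-a) and (1 - y)^(-b) turn it into a weighted sum of the f(n, (i, j)) with i, j ≥ 0, the weights
being a^i b^j with 0^0 = 1 (`walkGFAt_eq_diagonal`). -/

theorem aeval_rx_ry (p : MvPolynomial (Fin 2) ℚ) :
    aeval ![rx, ry] p = algebraMap (MvPolynomial (Fin 2) ℚ) RatXY p := by
  have h : aeval ![rx, ry] = IsScalarTower.toAlgHom ℚ (MvPolynomial (Fin 2) ℚ) RatXY := by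
    ext i
    fin_cases i <;> simp [rx, ry]
  rw [h]
  rfl

theorem intermediateField_eq_top {L : IntermediateField ℚ RatXY} (hx : rx ∈ L) (hy : ry ∈ L) :
    L = ⊤ := by
  have hp : ∀ p : MvPolynomial (Fin 2) ℚ, algebraMap (MvPolynomial (Fin 2) ℚ) RatXY p ∈ L := by
    intro p
    rw [← aeval_rx_ry]
    have h : L.val.comp (aeval ![⟨rx, hx⟩, ⟨ry, hy⟩]) = aeval ![rx, ry] := by
      ext i
      fin_cases i <;> simp
    rw [← h]
    exact (aeval (![⟨rx, hx⟩, ⟨ry, hy⟩] : Fin 2 → L) p).2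
  refine eq_top_iff.2 fun f _ => ?_
  obtain ⟨p, q, -, rfl⟩ := IsFractionRing.div_surjective (A := MvPolynomial (Fin 2) ℚ) f
  exact div_mem (hp p) (hp q)

theorem trdeg_ratXY : Algebra.trdeg ℚ RatXY = 2 := by
  have := IsLocalization.isAlgebraic RatXY
    (nonZeroDivisors (MvPolynomial (Fin 2) ℚ))
  have h := (IsTranscendenceBasis.mvPolynomial (Fin 2) ℚ).algebraMap_comp (A := RatXY)
  have := h.cardinalMk_eq_trdeg
  simpa using this.symm

theorem algHom_ext_rx_ry {F : Type*} [Field F] [Algebra ℚ F] {σ τ : RatXY →ₐ[ℚ] F}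
    (hx : σ rx = τ rx) (hy : σ ry = τ ry) : σ = τ := by
  have h : AlgHom.equalizer σ τ = (⊤ : Subalgebra ℚ RatXY) := by
    let L : IntermediateField ℚ RatXY :=
      { AlgHom.equalizer σ τ with
        inv_mem' := fun x hx => by
          change σ x⁻¹ = τ x⁻¹
          rw [map_inv₀, map_inv₀]
          exact congrArg _ hx }
    have hL : L = ⊤ := intermediateField_eq_top hx hy
    exact congrArg IntermediateField.toSubalgebra hL
  ext f
  have : f ∈ AlgHom.equalizer σ τ := h ▸ Algebra.mem_top
  exact this

theorem birational_ext {σ τ : Birational} (hx : σ rx = τ rx) (hy : σ ry = τ ry) : σ = τ := by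
  have := algHom_ext_rx_ry (σ := (σ : RatXY →ₐ[ℚ] RatXY)) (τ := τ) hx hy
  ext f
  exact DFunLike.congr_fun this f

/-- The homomorphism from `ℚ(x, y)` that takes `x, y` to algebraically independent `u, v`. -/
theorem exists_algHom {F : Type*} [Field F] [Algebra ℚ F] {u v : F}
    (h : AlgebraicIndependent ℚ ![u, v]) :
    ∃ σ : RatXY →ₐ[ℚ] F, σ rx = u ∧ σ ry = v := by
  have h : Function.Injective (aeval (R := ℚ) ![u, v]) := h
  refine ⟨IsFractionRing.liftAlgHom (A := MvPolynomial (Fin 2) ℚ) h, ?_, ?_⟩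
  · rw [rx, IsFractionRing.liftAlgHom_apply, IsFractionRing.lift_algebraMap]
    simp
  · rw [ry, IsFractionRing.liftAlgHom_apply, IsFractionRing.lift_algebraMap]
    simp

/-- Evaluation of rational functions at `u, v`, when the monomials `u^i v^j` have dual linear
functionals. -/
theorem exists_ringHom_eq_ratEval {F : Type*} [Field F] [Algebra ℚ F] {u v : F}
    (c : ℕ → ℕ → F →+ ℚ)
    (hc : ∀ i j k l, c i j (u ^ k * v ^ l) = if i = k ∧ j = l then 1 else 0) :
    ∃ σ : RatXY →+* F, σ rx = u ∧ σ ry = v ∧ ∀ f, ratEval f u v = σ f := by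
  have hind : AlgebraicIndependent ℚ ![u, v] := by
    refine (injective_iff_map_eq_zero _).2 fun p hp => ?_
    ext m
    -- The dual functionals recover every coefficient of `p` from its value, so evaluation is
    -- injective.
    have h : c (m 0) (m 1) (MvPolynomial.aeval ![u, v] p) = MvPolynomial.coeff m p := by
      rw [MvPolynomial.aeval_def, MvPolynomial.eval₂_eq', map_sum]
      have key : ∀ d : Fin 2 →₀ ℕ, c (m 0) (m 1)
          (algebraMap ℚ F (MvPolynomial.coeff d p) * ∏ i, ![u, v] i ^ d i) =
          if m = d then MvPolynomial.coeff d p else 0 := by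
        intro d
        rw [← Algebra.smul_def, map_rat_smul, Fin.prod_univ_two]
        simp only [Matrix.cons_val_zero, Matrix.cons_val_one]
        have : m 0 = d 0 ∧ m 1 = d 1 ↔ m = d := by
          rw [Finsupp.ext_iff, Fin.forall_fin_two]
        simp [this, hc]
      rw [Finset.sum_congr rfl fun d _ => key d]
      simp +contextual [eq_comm]
    rw [← h, hp, map_zero, MvPolynomial.coeff_zero]
  obtain ⟨σ, hx, hy⟩ := exists_algHom hind
  refine ⟨σ.toRingHom, hx, hy, fun f => ?_⟩
  have h : ∀ p : MvPolynomial (Fin 2) ℚ, MvPolynomial.aeval ![u, v] p =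
      σ (algebraMap (MvPolynomial (Fin 2) ℚ) RatXY p) := by
    intro p
    rw [← aeval_rx_ry, ← AlgHom.comp_apply]
    congr 1
    ext i : 1
    fin_cases i <;> simp [hx, hy]
  rw [ratEval, h, h, ← map_div₀, IsFractionRing.mk'_num_den']
  rfl

/-- Two generators of a field of transcendence degree 2 are algebraically independent, so the
substitution is defined on ℚ(x, y); its image contains the generators, so it is onto. -/
theorem exists_birational {u v : RatXY}
    (h : ∀ L : IntermediateField ℚ RatXY, u ∈ L → v ∈ L → rx ∈ L ∧ ry ∈ L) :
    ∃ σ : Birational, σ rx = u ∧ σ ry = v := by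
  have htop : IntermediateField.adjoin ℚ (Set.range ![u, v]) = ⊤ := by
    have hu : u ∈ IntermediateField.adjoin ℚ (Set.range ![u, v]) :=
      IntermediateField.subset_adjoin _ _ ⟨0, rfl⟩
    have hv : v ∈ IntermediateField.adjoin ℚ (Set.range ![u, v]) :=
      IntermediateField.subset_adjoin _ _ ⟨1, rfl⟩
    exact intermediateField_eq_top (h _ hu hv).1 (h _ hu hv).2
  have halg : Algebra.IsAlgebraic (Algebra.adjoin ℚ (Set.range ![u, v])) RatXY := by
    refine ⟨fun f => ?_⟩
    have hf : f ∈ IntermediateField.adjoin ℚ (Set.range ![u, v]) := htop ▸ trivial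
    rw [IntermediateField.mem_adjoin_iff_div] at hf
    obtain ⟨r, hr, s, hs, rfl⟩ := hf
    have key : ∀ r ∈ Algebra.adjoin ℚ (Set.range ![u, v]),
        IsAlgebraic (Algebra.adjoin ℚ (Set.range ![u, v])) r := fun r hr =>
      isAlgebraic_algebraMap (⟨r, hr⟩ : Algebra.adjoin ℚ (Set.range ![u, v]))
    rw [div_eq_mul_inv]
    exact (key r hr).mul (key s hs).inv
  have hind := (Algebra.IsAlgebraic.isTranscendenceBasis_of_le_trdeg_of_finite ℚ ![u, v]
    (by simp [trdeg_ratXY])).1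
  obtain ⟨σ, hx, hy⟩ := exists_algHom hind
  have hsurj : Function.Surjective σ := by
    have hr : σ.fieldRange = ⊤ :=
      have h' := h σ.fieldRange ⟨rx, hx⟩ ⟨ry, hy⟩
      intermediateField_eq_top h'.1 h'.2
    intro f
    have : f ∈ σ.fieldRange := hr ▸ trivial
    exact this
  exact ⟨AlgEquiv.ofBijective σ ⟨σ.toRingHom.injective, hsurj⟩, hx, hy⟩

theorem rx_ne_zero : rx ≠ 0 := by
  simp [rx]

theorem ry_ne_zero : ry ≠ 0 := by
  simp [ry]

theorem two_mul_rx_ry : ∃ σ : Birational, σ rx = 2 * rx ∧ σ ry = ry := by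
  refine exists_birational fun L hu hv => ⟨?_, hv⟩
  have : rx = 2⁻¹ * (2 * rx) := by ring
  rw [this]
  exact mul_mem (inv_mem (ofNat_mem L 2)) hu

theorem rx_mul_two_ry : ∃ σ : Birational, σ rx = rx ∧ σ ry = 2 * ry := by
  refine exists_birational fun L hu hv => ⟨hu, ?_⟩
  have : ry = 2⁻¹ * (2 * ry) := by ring
  rw [this]
  exact mul_mem (inv_mem (ofNat_mem L 2)) hv

/-- The scalings x ↦ 2x and y ↦ 2y multiply a monomial by powers of 2 that reveal its exponents. -/
theorem monomial_injective {i j k l : ℤ} (h : rx ^ i * ry ^ j = rx ^ k * ry ^ l) :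
    i = k ∧ j = l := by
  have inj : ∀ {m n : ℤ} {f : RatXY}, f ≠ 0 → (2 : RatXY) ^ m * f = 2 ^ n * f → m = n := by
    intro m n f hf h
    have h2 : (((2 : ℚ) ^ m : ℚ) : RatXY) = ((2 : ℚ) ^ n : ℚ) := by
      push_cast
      exact mul_right_cancel₀ hf h
    exact zpow_right_injective₀ (by norm_num) (by norm_num) (Rat.cast_injective h2)
  have hx := rx_ne_zero
  have hy := ry_ne_zero
  have hne : rx ^ k * ry ^ l ≠ 0 := mul_ne_zero (zpow_ne_zero _ hx) (zpow_ne_zero _ hy)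
  constructor
  · obtain ⟨σ, h1, h2⟩ := two_mul_rx_ry
    refine inj hne ?_
    have := congrArg σ h
    simp only [map_mul, map_zpow₀, h1, h2, mul_zpow, mul_assoc] at this
    rw [← h, this, h]
  · obtain ⟨σ, h1, h2⟩ := rx_mul_two_ry
    refine inj hne ?_
    have := congrArg σ h
    simp only [map_mul, map_zpow₀, h1, h2, mul_zpow, mul_left_comm (rx ^ (_ : ℤ)) ((2 : RatXY) ^ (_ : ℤ))]
      at this
    rw [← h, this, h]

end QuadrantWalk

namespace QuadrantWalk

/-! ### Groups generated by two involutions -/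

section Involutions

variable {G : Type*} [Group G] {a b : G}

theorem inv_mul_pow_of_involutions (ha : a * a = 1) (hb : b * b = 1) (i : ℤ) :
    a * (a * b) ^ i * a = (a * b) ^ (-i) := by
  have ha' : a⁻¹ = a := inv_eq_of_mul_eq_one_left ha
  have hb' : b⁻¹ = b := inv_eq_of_mul_eq_one_left hb
  have h : a * (a * b) * a⁻¹ = (a * b)⁻¹ := by
    rw [mul_inv_rev, ha', hb', ← mul_assoc a a b, ha, one_mul]
  calc a * (a * b) ^ i * a = (a * (a * b) * a⁻¹) ^ i := by rw [conj_zpow, ha']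
    _ = _ := by rw [h, inv_zpow, zpow_neg]

/-- Conjugation by `a * b` raises the exponent by 2, so each of these elements is conjugate to `a`
or to `b`. -/
theorem pow_mul_ne_one_of_involutions (ha : a * a = 1) (hb : b * b = 1) (ha1 : a ≠ 1)
    (hb1 : b ≠ 1) : ∀ i : ℕ, (a * b) ^ i * a ≠ 1
  | 0 => by simpa using ha1
  | 1 => by
    intro h
    have ha' : a⁻¹ = a := inv_eq_of_mul_eq_one_left ha
    have : a * b * a⁻¹ = 1 := by rwa [ha', ← pow_one (a * b)]
    exact hb1 (by simpa using conj_eq_one_iff.1 this)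
  | i + 2 => by
    intro h
    have ha' : a⁻¹ = a := inv_eq_of_mul_eq_one_left ha
    have hb' : b⁻¹ = b := inv_eq_of_mul_eq_one_left hb
    have : (a * b) * ((a * b) ^ i * a) * (a * b)⁻¹ = 1 := by
      rw [← h, mul_inv_rev, ha', hb', pow_succ (a * b) (i + 1), pow_succ' (a * b) i]
      simp only [mul_assoc]
    exact pow_mul_ne_one_of_involutions ha hb ha1 hb1 i (conj_eq_one_iff.1 this)

/-- Words in two involutions. -/
theorem prod_mem_of_involutions (ha : a * a = 1) (hb : b * b = 1) (l : List G)
    (hl : ∀ σ ∈ l, σ = a ∨ σ = b) :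
    (Even l.length → l.prod ∈ Subgroup.zpowers (a * b)) ∧
      (¬ Even l.length → l.prod * a ∈ Subgroup.zpowers (a * b)) := by
  induction l with
  | nil => simp
  | cons c l ih =>
    obtain ⟨h1, h2⟩ := ih fun σ hσ => hl σ (List.mem_cons_of_mem _ hσ)
    have hac : ∀ g ∈ Subgroup.zpowers (a * b), a * g * a ∈ Subgroup.zpowers (a * b) := by
      rintro _ ⟨i, rfl⟩
      exact ⟨-i, (inv_mul_pow_of_involutions ha hb i).symm⟩
    have hca : c * a ∈ Subgroup.zpowers (a * b) := by
      rcases hl c List.mem_cons_self with rfl | rfl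
      · rw [ha]
        exact one_mem _
      · refine ⟨-1, ?_⟩
        simp [inv_eq_of_mul_eq_one_left ha, inv_eq_of_mul_eq_one_left hb]
    have hcc : ∀ g, c * g = c * a * (a * g) := fun g => by
      rw [mul_assoc, ← mul_assoc a a g, ha, one_mul]
    rw [List.length_cons, Nat.even_add_one, List.prod_cons, not_not]
    constructor
    · intro h
      have h3 := hac _ (h2 h)
      rw [mul_assoc a, mul_assoc l.prod, ha, mul_one] at h3
      rw [hcc]
      exact mul_mem hca h3
    · intro h
      rw [mul_assoc, hcc, ← mul_assoc a]
      exact mul_mem hca (hac _ (h1 h))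

end Involutions

/-- The group generated by two distinct involutions whose product has order `m`, and the orbit
sum over it. -/
theorem orbitSum_of_involutions {S : Finset (ℤ × ℤ)} {a b : Birational}
    (hgen : generators S = {a, b}) (ha : a * a = 1) (hb : b * b = 1) (ha1 : a ≠ 1) (hb1 : b ≠ 1)
    (m : ℕ) (hm : 0 < m) (hab : orderOf (a * b) = m) :
    Finite (modelGroup S) ∧
      orbitSum S = ∑ i ∈ Finset.range m,
        (((a * b) ^ i) (rx * ry) - ((a * b) ^ i * a) (rx * ry)) := by
  have hfin : IsOfFinOrder (a * b) := orderOf_pos_iff.1 (hab ▸ hm)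
  have hpow : ∀ g ∈ Subgroup.zpowers (a * b), ∃ i < m, (a * b) ^ i = g := by
    intro g hg
    obtain ⟨k, rfl⟩ := hfin.mem_powers_iff_mem_zpowers.2 hg
    exact ⟨k % m, Nat.mod_lt _ hm, by rw [← hab]; exact pow_mod_orderOf _ _⟩
  -- Reflections are not rotations; hence all words for one group element have the same parity, and
  -- the sign does not depend on a minimal word.
  have hnot : ∀ i j : ℕ, (a * b) ^ i * a ≠ (a * b) ^ j := by
    intro i j h
    have : (a * b) ^ (i + (m * j - j)) * a = 1 := by
      have hj : j ≤ m * j := Nat.le_mul_of_pos_left j hm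
      rw [add_comm, pow_add, mul_assoc, h, ← pow_add, Nat.sub_add_cancel hj, pow_mul, ← hab,
        pow_orderOf_eq_one, one_pow]
    exact pow_mul_ne_one_of_involutions ha hb ha1 hb1 _ this
  have hword : ∀ l : List Birational, (∀ σ ∈ l, σ ∈ generators S) →
      (Even l.length → l.prod ∈ Subgroup.zpowers (a * b)) ∧
      (¬ Even l.length → l.prod * a ∈ Subgroup.zpowers (a * b)) := fun l hl =>
    prod_mem_of_involutions ha hb l fun σ hσ => by simpa [hgen] using hl σ hσ
  have hexists : ∀ g ∈ modelGroup S, ∃ l : List Birational,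
      (∀ σ ∈ l, σ ∈ generators S) ∧ l.prod = g := by
    intro g hg
    rw [modelGroup, ← Subgroup.mem_toSubmonoid, Subgroup.closure_toSubmonoid] at hg
    obtain ⟨l, hl, rfl⟩ := Submonoid.exists_list_of_mem_closure hg
    refine ⟨l, fun σ hσ => ?_, rfl⟩
    rcases hl σ hσ with h | h
    · exact h
    · rw [hgen] at h ⊢
      rcases h with h | h
      · left
        rw [← inv_inv σ, h]
        exact inv_eq_of_mul_eq_one_left ha
      · right
        rw [← inv_inv σ, h]
        exact inv_eq_of_mul_eq_one_left hb
  have hlen : ∀ g ∈ modelGroup S, ∃ l : List Birational,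
      (∀ σ ∈ l, σ ∈ generators S) ∧ l.prod = g ∧ l.length = wordLength S g := by
    intro g hg
    obtain ⟨l, hl, hlg⟩ := hexists g hg
    exact Nat.sInf_mem (s := {m | ∃ l : List Birational,
      (∀ σ ∈ l, σ ∈ generators S) ∧ l.prod = g ∧ l.length = m}) ⟨_, l, hl, hlg, rfl⟩
  have hamem : a ∈ modelGroup S := Subgroup.subset_closure (by simp [hgen])
  have hbmem : b ∈ modelGroup S := Subgroup.subset_closure (by simp [hgen])
  have hrmem : ∀ i : ℕ, (a * b) ^ i ∈ modelGroup S := fun i => pow_mem (mul_mem hamem hbmem) i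
  have hsgn1 : ∀ i : ℕ, (-1 : RatXY) ^ wordLength S ((a * b) ^ i) = 1 := by
    intro i
    obtain ⟨l, hl, hlg, hll⟩ := hlen _ (hrmem i)
    rw [← hll]
    refine Even.neg_one_pow (by_contra fun hodd => ?_)
    obtain ⟨j, -, hj⟩ := hpow _ ((hword l hl).2 hodd)
    exact hnot i j (by rw [hj, hlg])
  have hsgn2 : ∀ i : ℕ, (-1 : RatXY) ^ wordLength S ((a * b) ^ i * a) = -1 := by
    intro i
    obtain ⟨l, hl, hlg, hll⟩ := hlen _ (mul_mem (hrmem i) hamem)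
    rw [← hll]
    refine Odd.neg_one_pow (Nat.not_even_iff_odd.1 fun heven => ?_)
    obtain ⟨j, -, hj⟩ := hpow _ ((hword l hl).1 heven)
    exact hnot i j (by rw [hj, hlg])
  let e : Fin m ⊕ Fin m → modelGroup S :=
    Sum.elim (fun i => ⟨(a * b) ^ (i : ℕ), hrmem i⟩)
      (fun i => ⟨(a * b) ^ (i : ℕ) * a, mul_mem (hrmem i) hamem⟩)
  have hpinj : ∀ i j : Fin m, (a * b) ^ (i : ℕ) = (a * b) ^ (j : ℕ) → i = j := fun i j h =>
    Fin.ext (pow_injOn_Iio_orderOf (by simp [hab]) (by simp [hab]) h)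
  have he : Function.Bijective e := by
    constructor
    · rintro (i | i) (j | j) h
      · exact congrArg _ (hpinj i j (congrArg Subtype.val h))
      · exact absurd (congrArg Subtype.val h).symm (hnot j i)
      · exact absurd (congrArg Subtype.val h) (hnot i j)
      · exact congrArg _ (hpinj i j (mul_right_cancel (congrArg Subtype.val h)))
    · rintro ⟨g, hg⟩
      obtain ⟨l, hl, rfl⟩ := hexists g hg
      by_cases hev : Even l.length
      · obtain ⟨i, hi, h⟩ := hpow _ ((hword l hl).1 hev)
        exact ⟨Sum.inl ⟨i, hi⟩, Subtype.ext h⟩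
      · obtain ⟨i, hi, h⟩ := hpow _ ((hword l hl).2 hev)
        exact ⟨Sum.inr ⟨i, hi⟩, Subtype.ext (by simp [e, h, mul_assoc, ha])⟩
  refine ⟨Finite.of_surjective e he.2, ?_⟩
  rw [orbitSum, ← finsum_comp e he (g := fun g : modelGroup S =>
    (-1 : RatXY) ^ wordLength S (g : Birational) * (g : Birational) (rx * ry)),
    finsum_eq_sum_of_fintype, Fintype.sum_sum_type, Finset.sum_range, ← Finset.sum_add_distrib]
  refine Finset.sum_congr rfl fun i _ => ?_
  simp only [e, Sum.elim_inl, Sum.elim_inr]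
  rw [hsgn1, hsgn2]
  ring

end QuadrantWalk

namespace QuadrantWalk

open Finset

/-! ### Recursion for quadrant walks -/

theorem position_snoc_of_le {n k : ℕ} (w : Fin n → ℤ × ℤ) (s : ℤ × ℤ) (hk : k ≤ n) :
    position (Fin.snoc w s : Fin (n + 1) → ℤ × ℤ) k = position w k := by
  unfold position
  rw [Fin.sum_univ_castSucc]
  simp [Fin.snoc_castSucc, not_lt.2 hk]

theorem position_snoc_last {n : ℕ} (w : Fin n → ℤ × ℤ) (s : ℤ × ℤ) :
    position (Fin.snoc w s : Fin (n + 1) → ℤ × ℤ) (n + 1) = position w n + s := by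
  unfold position
  rw [Fin.sum_univ_castSucc]
  congr 1
  · refine sum_congr rfl fun m _ => ?_
    simp [Fin.snoc_castSucc, m.2, m.2.trans (Nat.lt_succ_self n)]
  · simp [Fin.snoc_last]

theorem mem_quadrantWalks {S : Finset (ℤ × ℤ)} {n : ℕ} {w : Fin n → ℤ × ℤ} :
    w ∈ quadrantWalks S n ↔ (∀ m, w m ∈ S) ∧
      ∀ k : Fin (n + 1), 0 ≤ (position w k).1 ∧ 0 ≤ (position w k).2 := by
  simp [quadrantWalks, Fintype.mem_piFinset]

theorem snoc_mem_quadrantWalks {S : Finset (ℤ × ℤ)} {n : ℕ} {w : Fin n → ℤ × ℤ} {s : ℤ × ℤ} :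
    (Fin.snoc w s : Fin (n + 1) → ℤ × ℤ) ∈ quadrantWalks S (n + 1) ↔
      w ∈ quadrantWalks S n ∧ s ∈ S ∧ 0 ≤ (position w n + s).1 ∧ 0 ≤ (position w n + s).2 := by
  rw [mem_quadrantWalks, mem_quadrantWalks, Fin.forall_fin_succ' (P := fun k : Fin (n + 1 + 1) =>
    0 ≤ (position (Fin.snoc w s : Fin (n + 1) → ℤ × ℤ) k).1 ∧
      0 ≤ (position (Fin.snoc w s : Fin (n + 1) → ℤ × ℤ) k).2), Fin.forall_fin_succ']
  simp only [Fin.snoc_castSucc, Fin.snoc_last, Fin.val_castSucc, Fin.val_last, position_snoc_last]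
  have : ∀ k : Fin (n + 1), position (Fin.snoc w s : Fin (n + 1) → ℤ × ℤ) k = position w k :=
    fun k => position_snoc_of_le w s (Nat.lt_succ_iff.1 k.2)
  simp only [this]
  tauto

/-- The number of quadrant walks of length `n` that end at `p`. -/
def endCount (S : Finset (ℤ × ℤ)) (n : ℕ) (p : ℤ × ℤ) : ℕ :=
  #{w ∈ quadrantWalks S n | position w n = p}

theorem endCount_zero (S : Finset (ℤ × ℤ)) (p : ℤ × ℤ) :
    endCount S 0 p = if p = 0 then 1 else 0 := by
  have h : quadrantWalks S 0 = univ := by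
    ext w
    simp only [mem_quadrantWalks, mem_univ, iff_true]
    exact ⟨fun m => m.elim0, fun k => by simp [position]⟩
  rw [endCount, h]
  by_cases hp : p = 0
  · simp [hp, position]
  · simp [hp, position, Ne.symm hp]

theorem endCount_eq_zero {S : Finset (ℤ × ℤ)} {n : ℕ} {p : ℤ × ℤ} (hp : p.1 < 0 ∨ p.2 < 0) :
    endCount S n p = 0 := by
  rw [endCount, card_eq_zero, filter_eq_empty_iff]
  rintro w hw rfl
  have := (mem_quadrantWalks.1 hw).2 (Fin.last n)
  simp only [Fin.val_last] at this
  omega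

theorem endCount_succ (S : Finset (ℤ × ℤ)) (n : ℕ) {p : ℤ × ℤ} (h1 : 0 ≤ p.1) (h2 : 0 ≤ p.2) :
    endCount S (n + 1) p = ∑ s ∈ S, endCount S n (p - s) := by
  rw [endCount, card_eq_sum_card_fiberwise (f := fun w => w (Fin.last n)) (t := S)]
  · refine sum_congr rfl fun s hs => ?_
    refine card_nbij' (fun w => Fin.init w) (fun w => (Fin.snoc w s : Fin (n + 1) → ℤ × ℤ))
      ?_ ?_ ?_ ?_
    · intro w hw
      simp only [coe_filter, mem_filter, Set.mem_ofPred_eq] at hw ⊢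
      obtain ⟨⟨hw, hp⟩, hl⟩ := hw
      rw [← Fin.snoc_init_self w, hl] at hw hp
      rw [position_snoc_last] at hp
      exact ⟨(snoc_mem_quadrantWalks.1 hw).1, eq_sub_of_add_eq hp⟩
    · intro w hw
      simp only [coe_filter, mem_filter, Set.mem_ofPred_eq] at hw ⊢
      have hp : position w n + s = p := by rw [hw.2, sub_add_cancel]
      refine ⟨⟨snoc_mem_quadrantWalks.2 ⟨hw.1, hs, ?_⟩, ?_⟩, Fin.snoc_last _ _⟩
      · rw [hp]
        exact ⟨h1, h2⟩
      · rw [position_snoc_last, hp]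
    · intro w hw
      simp only [coe_filter, mem_filter, Set.mem_ofPred_eq] at hw
      rw [← hw.2]
      exact Fin.snoc_init_self w
    · intro w _
      exact Fin.init_snoc _ _
  · intro w hw
    simp only [coe_filter, Set.mem_ofPred_eq] at hw
    exact (mem_quadrantWalks.1 hw.1).1 _

/-- The steps of `S` have coordinates in `{-1, 0, 1}`. -/
def IsSmall (S : Finset (ℤ × ℤ)) : Prop :=
  ∀ s ∈ S, (-1 ≤ s.1 ∧ s.1 ≤ 1) ∧ -1 ≤ s.2 ∧ s.2 ≤ 1

/-- Walks are determined by their recursion, the starting point and the vanishing on the boundary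
of the quadrant. -/
theorem eq_endCount_of_recursion {S : Finset (ℤ × ℤ)} (hS : IsSmall S) {f : ℕ → ℤ × ℤ → ℚ}
    (hrec : ∀ n p, 0 ≤ p.1 → 0 ≤ p.2 → f (n + 1) p = ∑ s ∈ S, f n (p - s))
    (h0 : ∀ p, 0 ≤ p.1 → 0 ≤ p.2 → f 0 p = if p = 0 then 1 else 0)
    (hb : ∀ n p, -1 ≤ p.1 → -1 ≤ p.2 → p.1 = -1 ∨ p.2 = -1 → f n p = 0) (n : ℕ) :
    ∀ p : ℤ × ℤ, -1 ≤ p.1 → -1 ≤ p.2 → f n p = endCount S n p := by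
  induction n with
  | zero =>
    intro p h1 h2
    by_cases hp : p.1 = -1 ∨ p.2 = -1
    · rw [hb 0 p h1 h2 hp, endCount_eq_zero (by omega), Nat.cast_zero]
    · rw [h0 p (by omega) (by omega), endCount_zero]
      split_ifs <;> simp
  | succ n ih =>
    intro p h1 h2
    by_cases hp : p.1 = -1 ∨ p.2 = -1
    · rw [hb _ p h1 h2 hp, endCount_eq_zero (by omega), Nat.cast_zero]
    · rw [hrec n p (by omega) (by omega), endCount_succ S n (by omega) (by omega), Nat.cast_sum]
      -- A small step back from the quadrant stays within coordinates at least -1, where the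
      -- induction hypothesis holds.
      refine sum_congr rfl fun s hs => ih _ ?_ ?_ <;> have := hS s hs <;>
        simp only [Prod.fst_sub, Prod.snd_sub] <;> omega

theorem IsSmall.image_swap {S : Finset (ℤ × ℤ)} (hS : IsSmall S) : IsSmall (S.image Prod.swap) := by
  intro s hs
  obtain ⟨t, ht, rfl⟩ := mem_image.1 hs
  exact ⟨(hS t ht).2, (hS t ht).1⟩

/-- The swapped counts obey the same recursion with the same initial and boundary values, so
uniqueness applies. -/
theorem endCount_image_swap {S : Finset (ℤ × ℤ)} (hS : IsSmall S) (n : ℕ) (p : ℤ × ℤ) :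
    endCount (S.image Prod.swap) n p.swap = endCount S n p := by
  by_cases hp : p.1 < 0 ∨ p.2 < 0
  · rw [endCount_eq_zero hp, endCount_eq_zero (by simpa [or_comm] using hp)]
  · have := eq_endCount_of_recursion hS
      (f := fun n p => endCount (S.image Prod.swap) n p.swap) ?_ ?_ ?_ n p (by omega) (by omega)
    · exact_mod_cast this
    · intro n p h1 h2
      rw [endCount_succ _ _ (by simpa using h2) (by simpa using h1),
        sum_image Prod.swap_injective.injOn, Nat.cast_sum]
      rfl
    · intro p _ _
      rw [endCount_zero]
      have : p.swap = 0 ↔ p = 0 := by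
        rw [Prod.ext_iff, Prod.ext_iff]
        exact and_comm
      simp [this]
    · intro n p _ _ h
      rw [endCount_eq_zero (by simp only [Prod.fst_swap, Prod.snd_swap]; omega), Nat.cast_zero]

theorem endCount_eq_zero_of_lt {S : Finset (ℤ × ℤ)} (hS : IsSmall S) {n : ℕ} {p : ℤ × ℤ}
    (hp : (n : ℤ) < p.1 ∨ (n : ℤ) < p.2) : endCount S n p = 0 := by
  induction n generalizing p with
  | zero =>
    rw [endCount_zero, if_neg]
    rintro rfl
    simp at hp
  | succ n ih =>
    by_cases hq : p.1 < 0 ∨ p.2 < 0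
    · exact endCount_eq_zero hq
    · rw [endCount_succ S n (by omega) (by omega)]
      refine sum_eq_zero fun s hs => ih ?_
      have := hS s hs
      simp only [Prod.fst_sub, Prod.snd_sub]
      push_cast at hp
      omega

/-- Antisymmetry under a linear reflection that preserves the steps, with the fixed point of the
reflection at `(-1, -1)`. -/
theorem antisymm_of_recursion {S : Finset (ℤ × ℤ)} {f : ℕ → ℤ × ℤ → ℚ} (U : Set (ℤ × ℤ))
    (ρ : ℤ × ℤ →+ ℤ × ℤ) (hρ : ∀ p, ρ (ρ p) = p) (hρS : ∀ s ∈ S, ρ s ∈ S)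
    (hrec : ∀ n p, f (n + 1) p = ∑ s ∈ S, f n (p - s))
    (hU : ∀ p ∈ U, ∀ s ∈ S, p - s ∉ U → ∀ n, f n (p - s) = 0 ∧
      f n (ρ (p - s + (1, 1)) - (1, 1)) = 0)
    (h0 : ∀ p ∈ U, f 0 (ρ (p + (1, 1)) - (1, 1)) = -f 0 p) (n : ℕ) :
    ∀ p ∈ U, f n (ρ (p + (1, 1)) - (1, 1)) = -f n p := by
  induction n with
  | zero => exact h0
  | succ n ih =>
    intro p hp
    rw [hrec, hrec, ← sum_neg_distrib]
    refine sum_nbij' ρ ρ hρS hρS (fun s _ => hρ s) (fun s _ => hρ s) fun s hs => ?_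
    -- A step `s` back from the reflected point is the reflection of the step `ρ s` back from `p`.
    have h1 : ρ (p + (1, 1)) - (1, 1) - s = ρ (p - ρ s + (1, 1)) - (1, 1) := by
      rw [show p - ρ s + (1, 1) = p + (1, 1) - ρ s by abel, map_sub, hρ]
      abel
    rw [h1]
    by_cases hps : p - ρ s ∈ U
    · exact ih _ hps
    · obtain ⟨h2, h3⟩ := hU p hp _ (hρS s hs) hps n
      rw [h2, h3, neg_zero]

end QuadrantWalk

namespace QuadrantWalk

open Finset Filter

noncomputable section

/-! ### Coefficients of iterated Laurent series -/

theorem inv_zpow_mul_inv_zpow (i j : ℤ) :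
    lx⁻¹ ^ i * ly⁻¹ ^ j = HahnSeries.single (-j) (HahnSeries.single (-i) (1 : ℚ)) := by
  have hx : lx⁻¹ ^ i = HahnSeries.C (HahnSeries.single (-i) (1 : ℚ)) := by
    rw [RatFunc.single_zpow, map_zpow₀, inv_zpow']
    rfl
  have hy : ly⁻¹ ^ j = HahnSeries.single (-j) 1 := by
    rw [ly, inv_zpow', ← RatFunc.single_zpow]
  rw [hx, hy, HahnSeries.C_mul_eq_smul]
  refine HahnSeries.ext (funext fun k => ?_)
  rw [HahnSeries.coeff_smul]
  by_cases hk : k = -j <;> simp [hk]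

theorem lx_ne_zero : lx ≠ 0 := by
  simp [lx]

theorem ly_ne_zero : ly ≠ 0 := by
  simp [ly]

/-- The coefficient of `x^(-i) y^(-j)`. -/
def invCoeff (p : ℤ × ℤ) : LaurentXY →+ ℚ where
  toFun F := (F.coeff (-p.2)).coeff (-p.1)
  map_zero' := rfl
  map_add' _ _ := rfl

theorem invCoeff_mul (p : ℤ × ℤ) (F : LaurentXY) (i j : ℤ) :
    invCoeff p (F * (lx⁻¹ ^ i * ly⁻¹ ^ j)) = invCoeff (p - (i, j)) F := by
  have h1 : -p.2 = -(p.2 - j) + -j := by ring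
  have h2 : -p.1 = -(p.1 - i) + -i := by ring
  change ((F * (lx⁻¹ ^ i * ly⁻¹ ^ j)).coeff (-p.2)).coeff (-p.1) =
    (F.coeff (-(p.2 - j))).coeff (-(p.1 - i))
  rw [inv_zpow_mul_inv_zpow, h1, HahnSeries.coeff_mul_single_add, h2,
    HahnSeries.coeff_mul_single_add, mul_one]

theorem invCoeff_one (p : ℤ × ℤ) : invCoeff p 1 = if p = 0 then 1 else 0 := by
  change ((1 : LaurentXY).coeff (-p.2)).coeff (-p.1) = _
  obtain ⟨i, j⟩ := p
  by_cases hj : j = 0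
  · subst hj
    by_cases hi : i = 0 <;> simp [hi, HahnSeries.coeff_one]
  · simp [hj, HahnSeries.coeff_one]

theorem invCoeff_monomial (p : ℤ × ℤ) (i j : ℤ) :
    invCoeff p (lx⁻¹ ^ i * ly⁻¹ ^ j) = if p = (i, j) then 1 else 0 := by
  rw [← one_mul (lx⁻¹ ^ i * ly⁻¹ ^ j), invCoeff_mul, invCoeff_one]
  simp [sub_eq_zero]

theorem invCoeff_mul_stepPoly (S : Finset (ℤ × ℤ)) (p : ℤ × ℤ) (F : LaurentXY) :
    invCoeff p (F * stepPoly S lx⁻¹ ly⁻¹) = ∑ s ∈ S, invCoeff (p - s) F := by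
  rw [stepPoly, mul_sum, map_sum]
  exact sum_congr rfl fun s _ => invCoeff_mul p F s.1 s.2

theorem exists_expand : ∃ σ : RatXY →+* LaurentXY,
    σ rx = lx⁻¹ ∧ σ ry = ly⁻¹ ∧ ∀ f, ratEval f lx⁻¹ ly⁻¹ = σ f := by
  refine exists_ringHom_eq_ratEval (F := LaurentXY) (fun i j => invCoeff (i, j)) fun i j k l => ?_
  have h := invCoeff_monomial (i, j) k l
  rw [zpow_natCast, zpow_natCast] at h
  simpa using h

/-- The expansion of rational functions of `x⁻¹, y⁻¹`. -/
def expand : RatXY →+* LaurentXY := exists_expand.choose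

theorem expand_rx : expand rx = lx⁻¹ := exists_expand.choose_spec.1

theorem expand_ry : expand ry = ly⁻¹ := exists_expand.choose_spec.2.1

theorem ratEval_eq_expand (f : RatXY) : ratEval f lx⁻¹ ly⁻¹ = expand f :=
  exists_expand.choose_spec.2.2 f

/-! ### The diagonal -/

/-- For `b = 1`, write h = g (1 - X): the sum telescopes to the constant term of g, since g has no
terms of very negative degree. For `b = 0` only `j = 0` survives, by 0^0 = 1. -/
theorem coeff_mul_one_sub_zpow {K : Type*} [Field K] (h : LaurentSeries K) {b : ℕ}
    (hb : b = 0 ∨ b = 1) : ∀ᶠ N in atTop,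
      (h * (1 - HahnSeries.single 1 1) ^ (-(b : ℤ))).coeff 0 =
        ∑ j ∈ range N, b ^ j • h.coeff (-(j : ℤ)) := by
  rcases hb with rfl | rfl
  · filter_upwards [eventually_ge_atTop 1] with N hN
    rw [sum_eq_single_of_mem 0 (mem_range.2 hN) fun j _ hj => by simp [hj]]
    simp
  · have hne : (1 - HahnSeries.single 1 1 : LaurentSeries K) ≠ 0 := by
      intro h0
      have := congrArg (fun g : LaurentSeries K => g.coeff 0) h0
      simp [HahnSeries.coeff_one] at this
    obtain ⟨g, rfl⟩ : ∃ g, h = g * (1 - HahnSeries.single 1 1) :=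
      ⟨h * (1 - HahnSeries.single 1 1)⁻¹, by rw [inv_mul_cancel_right₀ hne]⟩
    have hg : ∀ j : ℕ, (g * (1 - HahnSeries.single 1 1)).coeff (-(j : ℤ)) =
        g.coeff (-(j : ℤ)) - g.coeff (-((j + 1 : ℕ) : ℤ)) := by
      intro j
      rw [mul_sub, mul_one, HahnSeries.coeff_sub]
      congr 1
      rw [show -(j : ℤ) = -((j + 1 : ℕ) : ℤ) + 1 by push_cast; ring,
        HahnSeries.coeff_mul_single_add, mul_one]
    have hN : ∀ᶠ N : ℕ in atTop, -(N : ℤ) < g.order := by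
      filter_upwards [eventually_gt_atTop (-g.order).toNat] with N hN
      omega
    filter_upwards [hN] with N hN
    have hz : g.coeff (-(N : ℤ)) = 0 := HahnSeries.coeff_eq_zero_of_lt_order hN
    simp only [hg, one_pow, one_smul]
    rw [sum_range_sub' (fun j : ℕ => g.coeff (-(j : ℤ))) N, hz]
    simp [mul_inv_cancel_right₀ hne]

/-- The coefficient of t^n contains the factor (xy)^n, which moves the diagonal coefficient to the
constant term. -/
theorem diagonal_diagonand (S : Finset (ℤ × ℤ)) (a b n : ℕ) :
    PowerSeries.coeff n (diagonal (diagonand S a b)) =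
      invCoeff 0 (lx * ly * expand (orbitSum S) * stepPoly S lx⁻¹ ly⁻¹ ^ n *
        ((1 - lx) ^ (-(a : ℤ)) * (1 - ly) ^ (-(b : ℤ)))) := by
  have hgeom : ∀ v : LaurentXY, (1 - PowerSeries.X * PowerSeries.C v)⁻¹ =
      PowerSeries.mk fun n => v ^ n := by
    intro v
    symm
    rw [PowerSeries.eq_inv_iff_mul_eq_one (by simp)]
    ext k
    rw [mul_sub, mul_one, mul_comm PowerSeries.X, ← mul_assoc]
    cases k with
    | zero => simp
    | succ k => simp [PowerSeries.coeff_succ_mul_X, pow_succ, PowerSeries.coeff_one]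
  rw [diagonal, PowerSeries.coeff_mk, diagonand, hgeom, PowerSeries.coeff_mul_C,
    PowerSeries.coeff_C_mul, PowerSeries.coeff_mk, ratEval_eq_expand]
  set u := expand (orbitSum S)
  set v := stepPoly S lx⁻¹ ly⁻¹
  set w := (1 - lx) ^ (-(a : ℤ)) * (1 - ly) ^ (-(b : ℤ))
  have h : lx * ly * u * (lx * ly * v) ^ n * w =
      lx * ly * u * v ^ n * w * (lx⁻¹ ^ (-(n : ℤ)) * ly⁻¹ ^ (-(n : ℤ))) := by
    rw [inv_zpow', inv_zpow', neg_neg, zpow_natCast, zpow_natCast]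
    ring
  rw [h]
  have := invCoeff_mul (-(n : ℤ), -(n : ℤ)) (lx * ly * u * v ^ n * w) (-(n : ℤ)) (-(n : ℤ))
  rw [sub_self] at this
  rw [← this]
  simp [invCoeff]

theorem coeff_walkGFAt (S : Finset (ℤ × ℤ)) (a b : ℚ) (n : ℕ) :
    PowerSeries.coeff n (walkGFAt S a b) =
      ∑ i ∈ range (n + 1), ∑ j ∈ range (n + 1), (walkCount S i j n : ℚ) * (a ^ i * b ^ j) := by
  simp [walkGFAt, walkGF, PowerSeries.coeff_map, PowerSeries.coeff_mk]

theorem one_sub_lx_zpow (a : ℤ) :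
    (1 - lx) ^ a = HahnSeries.C ((1 - HahnSeries.single 1 1 : LaurentSeries ℚ) ^ a) := by
  rw [map_zpow₀, map_sub, map_one]
  rfl

theorem coeff_mul_C (F : LaurentXY) (w : LaurentSeries ℚ) (k : ℤ) :
    (F * HahnSeries.C w).coeff k = F.coeff k * w := by
  rw [mul_comm, HahnSeries.C_mul_eq_smul, HahnSeries.coeff_smul, smul_eq_mul, mul_comm]

theorem invCoeff_zero_mul (F : LaurentXY) {a b : ℕ} (ha : a = 0 ∨ a = 1) (hb : b = 0 ∨ b = 1)
    (n : ℕ) : ∃ N ≥ n, ∃ M ≥ n,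
      invCoeff 0 (F * ((1 - lx) ^ (-(a : ℤ)) * (1 - ly) ^ (-(b : ℤ)))) =
        ∑ j ∈ range N, ∑ i ∈ range M, invCoeff (i, j) F * (a ^ i * b ^ j) := by
  rw [one_sub_lx_zpow, ← mul_assoc]
  generalize hw : (1 - HahnSeries.single 1 1 : LaurentSeries ℚ) ^ (-(a : ℤ)) = w
  obtain ⟨N, hN, hnN⟩ := ((coeff_mul_one_sub_zpow (F * HahnSeries.C w) hb).and
    (eventually_ge_atTop n)).exists
  -- The outer variable y is cut off first; then one bound in x serves the finitely many remaining
  -- powers of y.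
  have hM : ∀ᶠ M in atTop, ∀ j ∈ range N, (F.coeff (-(j : ℤ)) * w).coeff 0 =
      ∑ i ∈ range M, a ^ i • (F.coeff (-(j : ℤ))).coeff (-(i : ℤ)) := by
    rw [Finset.eventually_all]
    intro j _
    rw [← hw]
    exact coeff_mul_one_sub_zpow _ ha
  obtain ⟨M, hM, hnM⟩ := (hM.and (eventually_ge_atTop n)).exists
  refine ⟨N, hnN, M, hnM, ?_⟩
  change ((F * HahnSeries.C w * (1 - HahnSeries.single 1 1) ^ (-(b : ℤ))).coeff 0).coeff 0 = _
  rw [hN]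
  change HahnSeries.coeff.addMonoidHom (0 : ℤ) _ = _
  rw [map_sum]
  refine sum_congr rfl fun j hj => ?_
  rw [map_nsmul, coeff_mul_C]
  change _ • (F.coeff (-(j : ℤ)) * w).coeff 0 = _
  rw [hM j hj, smul_sum]
  refine sum_congr rfl fun i _ => ?_
  change _ = (F.coeff (-(j : ℤ))).coeff (-(i : ℤ)) * _
  rw [nsmul_eq_mul, nsmul_eq_mul]
  push_cast
  ring

/-- The generating function is the diagonal as soon as the walks are counted by the coefficients of
the monomials of nonpositive exponents. -/
theorem walkGFAt_eq_diagonal {S : Finset (ℤ × ℤ)} (hS : IsSmall S)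
    (h : ∀ n (i j : ℕ), invCoeff (i, j) (lx * ly * expand (orbitSum S) *
      stepPoly S lx⁻¹ ly⁻¹ ^ n) = endCount S n (i, j))
    {a b : ℕ} (ha : a = 0 ∨ a = 1) (hb : b = 0 ∨ b = 1) :
    walkGFAt S a b = diagonal (diagonand S a b) := by
  ext n
  rw [diagonal_diagonand, coeff_walkGFAt]
  obtain ⟨N, hnN, M, hnM, hNM⟩ := invCoeff_zero_mul
    (lx * ly * expand (orbitSum S) * stepPoly S lx⁻¹ ly⁻¹ ^ n) ha hb (n + 1)
  -- The two ranges of summation differ only at end points out of reach in `n` small steps.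
  have hzero : ∀ i j : ℕ, i ∉ range (n + 1) ∨ j ∉ range (n + 1) →
      (endCount S n (i, j) : ℚ) * (a ^ i * b ^ j) = 0 := by
    intro i j hij
    rw [endCount_eq_zero_of_lt hS, Nat.cast_zero, zero_mul]
    simp only [mem_range] at hij
    omega
  rw [hNM]
  simp only [h]
  refine Eq.trans ?_ sum_comm
  exact (sum_congr rfl fun i _ => sum_subset (range_mono hnN) fun j _ hj =>
    hzero i j (Or.inr hj)).trans (sum_subset (range_mono hnM) fun i _ hi =>
      sum_eq_zero fun j _ => hzero i j (Or.inl hi))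

end

end QuadrantWalk

namespace QuadrantWalk

open Finset

noncomputable section

/-! ### Step sets and swapped step sets -/

theorem coeffB_eq_coeffA_image_swap {F : Type*} [Field F] (S : Finset (ℤ × ℤ)) (k : ℤ) (v : F) :
    coeffB S k v = coeffA (S.image Prod.swap) k v := by
  rw [coeffB, coeffA, filter_image, sum_image Prod.swap_injective.injOn]
  rfl

theorem stepPoly_image_swap {F : Type*} [Field F] (S : Finset (ℤ × ℤ)) (u v : F) :
    stepPoly (S.image Prod.swap) v u = stepPoly S u v := by
  rw [stepPoly, stepPoly, sum_image Prod.swap_injective.injOn]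
  exact sum_congr rfl fun _ _ => mul_comm _ _

theorem map_coeffA {F F' : Type*} [Field F] [Field F'] (φ : F →+* F') (S : Finset (ℤ × ℤ)) (k : ℤ)
    (u : F) : φ (coeffA S k u) = coeffA S k (φ u) := by
  simp [coeffA, map_sum, map_zpow₀]

theorem birational_coeffA (σ : Birational) (S : Finset (ℤ × ℤ)) (k : ℤ) (u : RatXY) :
    σ (coeffA S k u) = coeffA S k (σ u) :=
  map_coeffA (σ : RatXY →+* RatXY) S k u

theorem expand_coeffA (S : Finset (ℤ × ℤ)) (k : ℤ) (f : RatXY) :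
    expand (coeffA S k f) = coeffA S k (expand f) :=
  map_coeffA (F' := LaurentXY) expand S k f

/-- After expansion the coefficients are counts of steps, so nothing cancels. -/
theorem coeffA_rx_ne_zero {S : Finset (ℤ × ℤ)} {k : ℤ} (h : ∃ s ∈ S, s.2 = k) :
    coeffA S k rx ≠ 0 := by
  obtain ⟨t, ht, hk⟩ := h
  intro h0
  have h1 := congrArg (fun f => invCoeff (t.1, 0) (expand f)) h0
  simp only [expand_coeffA, expand_rx, map_zero] at h1
  rw [coeffA, map_sum] at h1
  have h2 : ∀ s : ℤ × ℤ, invCoeff (t.1, 0) (lx⁻¹ ^ s.1) = if t.1 = s.1 then 1 else 0 := by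
    intro s
    have := invCoeff_monomial (t.1, 0) s.1 0
    rw [zpow_zero, mul_one] at this
    simpa using this
  rw [sum_congr rfl fun s _ => h2 s] at h1
  have h3 := (sum_eq_zero_iff_of_nonneg (fun s _ => by split_ifs <;> simp)).1 h1 t (by simp [ht, hk])
  simp at h3

/-- The reflection in the vertical axis preserves the steps. -/
def IsVerticallySymmetric (S : Finset (ℤ × ℤ)) : Prop :=
  ∀ s ∈ S, (-s.1, s.2) ∈ S

theorem IsVerticallySymmetric.coeffA_inv {S : Finset (ℤ × ℤ)} (hS : IsVerticallySymmetric S)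
    {F : Type*} [Field F] (k : ℤ) (u : F) : coeffA S k u⁻¹ = coeffA S k u := by
  have h : ∀ s ∈ {p ∈ S | p.2 = k}, (-s.1, s.2) ∈ {p ∈ S | p.2 = k} := by
    intro s hs
    rw [mem_filter] at hs ⊢
    exact ⟨hS s hs.1, hs.2⟩
  exact sum_nbij' (fun s => (-s.1, s.2)) (fun s => (-s.1, s.2)) h h (fun s _ => by simp)
    (fun s _ => by simp) fun s _ => by simp

theorem IsVerticallySymmetric.coeffB_neg {S : Finset (ℤ × ℤ)} (hS : IsVerticallySymmetric S)
    {F : Type*} [Field F] (k : ℤ) (v : F) : coeffB S (-k) v = coeffB S k v := by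
  refine sum_nbij' (fun s => (-s.1, s.2)) (fun s => (-s.1, s.2)) ?_ ?_ (fun s _ => by simp)
    (fun s _ => by simp) fun s _ => by simp
  all_goals
    intro s hs
    rw [mem_filter] at hs ⊢
    refine ⟨hS s hs.1, ?_⟩
    simp [hs.2]

/-! ### The group of a symmetric model -/

/-- `x, y` or `y, x`, as coordinates of the plane. -/
structure IsCoordinates (X Y : RatXY) : Prop where
  mul_eq : X * Y = rx * ry
  ne_zero : X ≠ 0 ∧ Y ≠ 0
  ext : ∀ σ τ : Birational, σ X = τ X → σ Y = τ Y → σ = τ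
  exists_map : ∃ σ : Birational, σ rx = X ∧ σ ry = Y
  exists_birational : ∀ u v : RatXY,
    (∀ L : IntermediateField ℚ RatXY, u ∈ L → v ∈ L → X ∈ L ∧ Y ∈ L) →
      ∃ σ : Birational, σ X = u ∧ σ Y = v

theorem isCoordinates_rx_ry : IsCoordinates rx ry where
  mul_eq := rfl
  ne_zero := ⟨rx_ne_zero, ry_ne_zero⟩
  ext _ _ := birational_ext
  exists_map := ⟨1, rfl, rfl⟩
  exists_birational _ _ := QuadrantWalk.exists_birational

theorem isCoordinates_ry_rx : IsCoordinates ry rx where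
  mul_eq := mul_comm _ _
  ne_zero := ⟨ry_ne_zero, rx_ne_zero⟩
  ext _ _ h1 h2 := birational_ext h2 h1
  exists_map := QuadrantWalk.exists_birational fun _ h1 h2 => ⟨h2, h1⟩
  exists_birational u v h := by
    obtain ⟨σ, h1, h2⟩ := QuadrantWalk.exists_birational (u := v) (v := u)
      fun L hv hu => (h L hu hv).symm
    exact ⟨σ, h2, h1⟩

theorem coeffA_mem {L : IntermediateField ℚ RatXY} {u : RatXY} (hu : u ∈ L) (S : Finset (ℤ × ℤ))
    (k : ℤ) : coeffA S k u ∈ L :=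
  sum_mem fun _ _ => zpow_mem hu _

theorem IsCoordinates.coeffA_ne_zero {X Y : RatXY} (hXY : IsCoordinates X Y) {S : Finset (ℤ × ℤ)}
    {k : ℤ} (h : ∃ s ∈ S, s.2 = k) : coeffA S k X ≠ 0 := by
  obtain ⟨σ, h1, -⟩ := hXY.exists_map
  rw [← h1, ← birational_coeffA]
  exact (map_ne_zero σ).2 (coeffA_rx_ne_zero h)

/-- The group and the orbit sum of a model whose steps are symmetric, in the coordinates in which
they are vertically symmetric. -/
theorem IsCoordinates.orbitSum_eq {X Y : RatXY} (hXY : IsCoordinates X Y) {S T : Finset (ℤ × ℤ)}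
    (hT : IsVerticallySymmetric T) (h1 : ∃ s ∈ T, s.2 = 1) (h2 : ∃ s ∈ T, s.2 = -1)
    (hgen : ∀ σ, σ ∈ generators S ↔
      (σ X = X ∧ σ Y = Y⁻¹ * (coeffA T (-1) X / coeffA T 1 X)) ∨ (σ X = X⁻¹ ∧ σ Y = Y)) :
    Finite (modelGroup S) ∧
      orbitSum S = (X - X⁻¹) * (Y - Y⁻¹ * (coeffA T (-1) X / coeffA T 1 X)) := by
  obtain ⟨hX, hY⟩ := hXY.ne_zero
  set c := coeffA T (-1) X / coeffA T 1 X with hc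
  have hc0 : c ≠ 0 := div_ne_zero (hXY.coeffA_ne_zero h2) (hXY.coeffA_ne_zero h1)
  -- `c` depends on X alone and, by symmetry, not on the sign of its exponent. Both generators
  -- therefore fix it, and so they commute.
  have hfix : ∀ φ : Birational, φ X = X → φ c = c := by
    intro φ h
    rw [hc, map_div₀, birational_coeffA, birational_coeffA, h]
  have hflip : ∀ φ : Birational, φ X = X⁻¹ → φ c = c := by
    intro φ h
    rw [hc, map_div₀, birational_coeffA, birational_coeffA, h, hT.coeffA_inv, hT.coeffA_inv]
  obtain ⟨σ, hσX, hσY⟩ := hXY.exists_birational X (Y⁻¹ * c) fun L hL1 hL2 => by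
    refine ⟨hL1, ?_⟩
    have hcL : c ∈ L := div_mem (coeffA_mem hL1 T _) (coeffA_mem hL1 T _)
    rw [show Y = c * (Y⁻¹ * c)⁻¹ by field_simp]
    exact mul_mem hcL (inv_mem hL2)
  obtain ⟨τ, hτX, hτY⟩ := hXY.exists_birational X⁻¹ Y fun L hL1 hL2 =>
    ⟨inv_inv X ▸ inv_mem hL1, hL2⟩
  have half : ∀ {L : IntermediateField ℚ RatXY} {f : RatXY}, 2 * f ∈ L → f ∈ L := by
    intro L f h
    rw [show f = 2⁻¹ * (2 * f) by ring]
    exact mul_mem (inv_mem (ofNat_mem L 2)) h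
  -- The scalings `δ` and `ε` serve only to show that neither involution is the identity.
  obtain ⟨δ, hδX, hδY⟩ := hXY.exists_birational X (2 * Y) fun L hL1 hL2 => ⟨hL1, half hL2⟩
  obtain ⟨ε, hεX, hεY⟩ := hXY.exists_birational (2 * X) Y fun L hL1 hL2 => ⟨half hL1, hL2⟩
  have ne_scale : ∀ f : RatXY, f ≠ 0 → 2⁻¹ * f ≠ 2 * f := by
    intro f hf h
    have := mul_right_cancel₀ hf h
    norm_num at this
  have hXX : X⁻¹ ≠ X := by
    intro h
    have h' := congrArg ε h
    rw [map_inv₀, hεX, mul_inv, h] at h'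
    exact ne_scale X hX h'
  have hYY : Y⁻¹ * c ≠ Y := by
    intro h
    have h' := congrArg δ h
    rw [map_mul, map_inv₀, hδY, hfix δ hδX, mul_inv, mul_assoc, h] at h'
    exact ne_scale Y hY h'
  have hσ1 : σ ≠ 1 := by
    rintro rfl
    exact hYY hσY.symm
  have hτ1 : τ ≠ 1 := by
    rintro rfl
    exact hXX hτX.symm
  have hσc := hfix σ hσX
  have hτc := hflip τ hτX
  have hσσ : σ * σ = 1 := by
    refine hXY.ext _ _ ?_ ?_
    · simp [hσX]
    · simp only [AlgEquiv.mul_apply, hσY, map_mul, map_inv₀, hσc, AlgEquiv.one_apply]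
      field_simp
  have hττ : τ * τ = 1 := by
    refine hXY.ext _ _ ?_ ?_
    · simp [hτX]
    · simp [hτY]
  have hord : orderOf (σ * τ) = 2 := by
    refine orderOf_eq_prime ?_ ?_
    · rw [pow_two]
      refine hXY.ext _ _ ?_ ?_
      · simp [hσX, hτX]
      · simp only [AlgEquiv.mul_apply, hσY, hτY, map_mul, map_inv₀, hσc, hτc, AlgEquiv.one_apply]
        field_simp
    · intro h
      have h' := congrArg (fun g : Birational => g X) h
      simp only [AlgEquiv.mul_apply, hτX, map_inv₀, hσX, AlgEquiv.one_apply] at h'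
      exact hXX h'
  have hset : generators S = {σ, τ} := by
    ext g
    rw [hgen, Set.mem_insert_iff, Set.mem_singleton_iff]
    constructor
    · rintro (⟨hx, hy⟩ | ⟨hx, hy⟩)
      · exact Or.inl (hXY.ext _ _ (hx.trans hσX.symm) (hy.trans hσY.symm))
      · exact Or.inr (hXY.ext _ _ (hx.trans hτX.symm) (hy.trans hτY.symm))
    · rintro (rfl | rfl)
      · exact Or.inl ⟨hσX, hσY⟩
      · exact Or.inr ⟨hτX, hτY⟩
  obtain ⟨hfin, hsum⟩ := orbitSum_of_involutions hset hσσ hττ hσ1 hτ1 2 two_pos hord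
  refine ⟨hfin, ?_⟩
  rw [hsum, ← hXY.mul_eq]
  simp only [sum_range_succ, range_zero, sum_empty, pow_zero, pow_one, AlgEquiv.mul_apply,
    AlgEquiv.one_apply, map_mul, hσX, hσY, hτX, hτY, map_inv₀, hσc, hτc]
  field_simp
  ring

/-! ### Coefficients of the orbit sum of a symmetric model -/

/-- Reflection principle for three-term recursions over a field. -/
theorem reflection_of_recursion {K : Type*} [Field K] {a b d : K} (ha : a ≠ 0) (hd : d ≠ 0)
    {u : ℕ → ℤ → K} (hu : ∀ n k, u (n + 1) k = u n (k - 1) * a + u n k * b + u n (k + 1) * d)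
    (h0 : ∀ k, u 0 (-2 - k) = -((d / a) ^ (k + 1) * u 0 k)) (n : ℕ) :
    ∀ k, u n (-2 - k) = -((d / a) ^ (k + 1) * u n k) := by
  induction n with
  | zero => exact h0
  | succ n ih =>
    intro k
    have hq : d / a ≠ 0 := div_ne_zero hd ha
    have h1 : u n (-2 - k - 1) = -((d / a) ^ (k + 1) * (d / a) * u n (k + 1)) := by
      rw [show -2 - k - 1 = -2 - (k + 1) by ring, ih, zpow_add_one₀ hq]
    have h2 : u n (-2 - k + 1) * (d / a) = -((d / a) ^ (k + 1) * u n (k - 1)) := by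
      rw [show -2 - k + 1 = -2 - (k - 1) by ring, ih, show k + 1 = k - 1 + 1 + 1 by ring,
        zpow_add_one₀ hq (k - 1 + 1)]
      ring
    have h3 : u n (-2 - k + 1) * d = -((d / a) ^ (k + 1) * u n (k - 1)) * a := by
      rw [← h2]
      field_simp
    rw [hu, hu, ih, h1, h3]
    field_simp
    ring

/-- `X k` takes the coefficient of `w^(-k)`, a Laurent series in `z`. -/
structure IsCoeffFamily (z w : LaurentXY) (X : ℤ → LaurentXY →+ LaurentSeries ℚ) : Prop where
  mul_monomial : ∀ k F i j,
    X k (F * (z⁻¹ ^ i * w⁻¹ ^ j)) = X (k - j) F * (HahnSeries.single (-i) 1 : LaurentSeries ℚ)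
  one : ∀ k, X k 1 = if k = 0 then 1 else 0

/-- `A_k(z⁻¹)`. -/
def laurentA (S : Finset (ℤ × ℤ)) (k : ℤ) : LaurentSeries ℚ :=
  ∑ p ∈ S with p.2 = k, HahnSeries.single (-p.1) 1

theorem laurentA_ne_zero {S : Finset (ℤ × ℤ)} {k : ℤ} (h : ∃ s ∈ S, s.2 = k) :
    laurentA S k ≠ 0 := by
  obtain ⟨t, ht, hk⟩ := h
  intro h0
  have h1 := congrArg (HahnSeries.coeff.addMonoidHom (-t.1)) h0
  rw [laurentA, map_sum, map_zero] at h1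
  have h2 : ∀ s : ℤ × ℤ, HahnSeries.coeff.addMonoidHom (-t.1) (HahnSeries.single (-s.1) (1 : ℚ)) =
      if t.1 = s.1 then 1 else 0 := by
    intro s
    change (HahnSeries.single (-s.1) (1 : ℚ)).coeff (-t.1) = _
    rw [HahnSeries.coeff_single]
    simp
  rw [sum_congr rfl fun s _ => h2 s] at h1
  have h3 := (sum_eq_zero_iff_of_nonneg (fun s _ => by split_ifs <;> simp)).1 h1 t (by simp [ht, hk])
  simp at h3

theorem IsCoeffFamily.mul_coeffA {z w : LaurentXY} {X : ℤ → LaurentXY →+ LaurentSeries ℚ}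
    (hX : IsCoeffFamily z w X) (S : Finset (ℤ × ℤ)) (m k : ℤ) (F : LaurentXY) :
    X k (F * coeffA S m z⁻¹) = X k F * laurentA S m := by
  rw [coeffA, laurentA, mul_sum, mul_sum, map_sum]
  refine sum_congr rfl fun s _ => ?_
  have := hX.mul_monomial k F s.1 0
  rwa [zpow_zero, mul_one, sub_zero] at this

theorem IsCoeffFamily.mul_stepPoly {z w : LaurentXY} {X : ℤ → LaurentXY →+ LaurentSeries ℚ}
    (hX : IsCoeffFamily z w X) (S : Finset (ℤ × ℤ)) (k : ℤ) (F : LaurentXY) :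
    X k (F * stepPoly S z⁻¹ w⁻¹) =
      ∑ s ∈ S, X (k - s.2) F * HahnSeries.single (-s.1) 1 := by
  rw [stepPoly, mul_sum, map_sum]
  exact sum_congr rfl fun s _ => hX.mul_monomial k F s.1 s.2

theorem sum_eq_sum_levels {S : Finset (ℤ × ℤ)} (hS : IsSmall S) {M : Type*} [AddCommMonoid M]
    (f : ℤ × ℤ → M) : ∑ s ∈ S, f s =
      ∑ s ∈ S with s.2 = 1, f s + ∑ s ∈ S with s.2 = 0, f s + ∑ s ∈ S with s.2 = -1, f s := by
  have : ∀ s ∈ S, f s = (if s.2 = 1 then f s else 0) + (if s.2 = 0 then f s else 0) +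
      if s.2 = -1 then f s else 0 := by
    intro s hs
    have h := hS s hs
    obtain h | h | h : s.2 = 1 ∨ s.2 = 0 ∨ s.2 = -1 := by omega
    all_goals simp [h]
  rw [sum_congr rfl this, sum_add_distrib, sum_add_distrib, sum_filter, sum_filter, sum_filter]

/-- Here `F` is zw times the expanded orbit sum, with its denominator A₁ cleared in `hF`. Reflection
in w gives the zero line p.2 = -1; reflection in z above that line gives the other one. -/
theorem IsCoeffFamily.eq_endCount {z w : LaurentXY} {X : ℤ → LaurentXY →+ LaurentSeries ℚ}
    (hX : IsCoeffFamily z w X) {S : Finset (ℤ × ℤ)} (hS : IsSmall S)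
    (hsym : IsVerticallySymmetric S) (h1 : ∃ s ∈ S, s.2 = 1) (h2 : ∃ s ∈ S, s.2 = -1)
    {F : LaurentXY} (hF : F * coeffA S 1 z⁻¹ =
      (1 - z ^ 2) * (coeffA S 1 z⁻¹ - w ^ 2 * coeffA S (-1) z⁻¹)) (n : ℕ) (p : ℤ × ℤ)
    (hp1 : 0 ≤ p.1) (hp2 : 0 ≤ p.2) :
    (X p.2 (F * stepPoly S z⁻¹ w⁻¹ ^ n)).coeff (-p.1) = (endCount S n p : ℚ) := by
  set u : ℕ → ℤ → LaurentSeries ℚ := fun n k => X k (F * stepPoly S z⁻¹ w⁻¹ ^ n) with hu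
  set f : ℕ → ℤ × ℤ → ℚ := fun n p => (u n p.2).coeff (-p.1) with hf
  have ha := laurentA_ne_zero h1
  have hd := laurentA_ne_zero h2
  have hurec : ∀ n k, u (n + 1) k = ∑ s ∈ S, u n (k - s.2) * HahnSeries.single (-s.1) 1 := by
    intro n k
    simp only [hu]
    rw [pow_succ, ← mul_assoc, hX.mul_stepPoly]
  have hlevel : ∀ n k m, ∑ s ∈ S with s.2 = m, u n (k - s.2) * HahnSeries.single (-s.1) 1 =
      u n (k - m) * laurentA S m := by
    intro n k m
    rw [laurentA, mul_sum]
    refine sum_congr rfl fun s hs => ?_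
    rw [(mem_filter.1 hs).2]
  have hurec3 : ∀ n k, u (n + 1) k =
      u n (k - 1) * laurentA S 1 + u n k * laurentA S 0 + u n (k + 1) * laurentA S (-1) := by
    intro n k
    rw [hurec, sum_eq_sum_levels hS, hlevel, hlevel, hlevel, sub_zero, sub_neg_eq_add]
  have hu0 : ∀ k, u 0 k = (1 - HahnSeries.single 2 1) *
      ((if k = 0 then 1 else 0) - (if k = -2 then laurentA S (-1) / laurentA S 1 else 0)) := by
    intro k
    have hz : ∀ k G, X k (G * z ^ 2) = X k G * HahnSeries.single 2 1 := by
      intro k G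
      have := hX.mul_monomial k G (-2) 0
      rw [zpow_zero, mul_one, sub_zero, neg_neg, inv_zpow', neg_neg] at this
      exact_mod_cast this
    have hw : ∀ k G, X k (G * w ^ 2) = X (k + 2) G := by
      intro k G
      have := hX.mul_monomial k G 0 (-2)
      rw [zpow_zero, one_mul, sub_neg_eq_add, neg_zero, inv_zpow', neg_neg,
        HahnSeries.single_zero_one, mul_one] at this
      exact_mod_cast this
    have hexp : F * coeffA S 1 z⁻¹ = 1 * coeffA S 1 z⁻¹ - 1 * coeffA S 1 z⁻¹ * z ^ 2 -
        (1 * w ^ 2 * coeffA S (-1) z⁻¹ - 1 * w ^ 2 * coeffA S (-1) z⁻¹ * z ^ 2) := by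
      rw [hF]
      ring
    have := congrArg (X k) hexp
    simp only [map_sub, hz, hX.mul_coeffA, hw, hX.one] at this
    have h0 : u 0 k = X k F := by simp only [hu, pow_zero, mul_one]
    rw [h0, eq_div_of_mul_eq ha this]
    simp only [show k + 2 = 0 ↔ k = -2 by omega]
    split_ifs <;> field_simp <;> ring
  have hanti := reflection_of_recursion ha hd hurec3 fun k => by
    rw [hu0, hu0]
    have hq := div_ne_zero hd ha
    generalize laurentA S (-1) / laurentA S 1 = q at hq ⊢
    by_cases hk : k = 0
    · subst hk
      simp [mul_comm]
    · by_cases hk' : k = -2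
      · subst hk'
        simp only [show ((-2 : ℤ) - -2 = 0) by rfl, show (-2 : ℤ) + 1 = -1 by rfl, zpow_neg_one]
        rw [mul_left_comm]
        simp [hq]
      · rw [if_neg (by omega), if_neg (by omega), if_neg hk, if_neg hk']
        simp
  -- The index -1 is the fixed point of k ↦ -2 - k, and its weight is (d/a)^0 = 1.
  have hbot : ∀ n i, f n (i, -1) = 0 := by
    intro n i
    have h := hanti n (-1)
    simp only [show (-2 : ℤ) - -1 = -1 by rfl, neg_add_cancel, zpow_zero, one_mul] at h
    have h' := congrArg (fun g : LaurentSeries ℚ => g.coeff (-i)) h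
    simp only [HahnSeries.coeff_neg] at h'
    change (u n (-1)).coeff (-i) = 0
    linarith
  have hfrec : ∀ n p, f (n + 1) p = ∑ s ∈ S, f n (p - s) := by
    intro n p
    change HahnSeries.coeff.addMonoidHom (-p.1) (u (n + 1) p.2) = _
    rw [hurec, map_sum]
    refine sum_congr rfl fun s _ => ?_
    change (u n (p.2 - s.2) * HahnSeries.single (-s.1) 1).coeff (-p.1) =
      (u n (p.2 - s.2)).coeff (-(p.1 - s.1))
    rw [show -p.1 = -(p.1 - s.1) + -s.1 by ring, HahnSeries.coeff_mul_single_add, mul_one]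
  have hf0 : ∀ p : ℤ × ℤ, 0 ≤ p.2 → f 0 p =
      if p.2 = 0 then (if p.1 = 0 then 1 else 0) - (if p.1 = -2 then 1 else 0) else 0 := by
    rintro ⟨i, j⟩ hj
    simp only at hj
    simp only [hf, hu0]
    rw [if_neg (show ¬ j = -2 by omega), sub_zero]
    by_cases hj0 : j = 0
    · simp only [hj0, if_true, mul_one, HahnSeries.coeff_sub, HahnSeries.coeff_one,
        HahnSeries.coeff_single]
      congr 1
      · simp
      · simp only [show -i = 2 ↔ i = -2 by omega]
    · simp [hj0]
  -- On this half plane the initial value is 1 - z², antisymmetric under i ↦ -2 - i. A step that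
  -- leaves it lands on the zero line, so the quotient A₋₁/A₁, whose expansion need not be
  -- symmetric, never enters.
  have hside := antisymm_of_recursion {p | 0 ≤ p.2}
    ((-AddMonoidHom.fst ℤ ℤ).prod (AddMonoidHom.snd ℤ ℤ)) (by simp)
    (fun s hs => hsym s hs) hfrec
    (by
      intro p hp s hs hps n
      have h := hS s hs
      simp only [Set.mem_ofPred_eq, Prod.snd_sub] at hp hps
      have h' : p.2 - s.2 = -1 := by omega
      constructor
      · rw [show p - s = (p.1 - s.1, -1) from Prod.ext rfl h', hbot]
      · simp only [AddMonoidHom.prod_apply, AddMonoidHom.neg_apply, AddMonoidHom.coe_fst,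
          AddMonoidHom.coe_snd, Prod.mk_sub_mk, Prod.snd_add, Prod.snd_sub, h']
        exact hbot n _)
    (by
      intro p hp
      have hp' : 0 ≤ p.2 := hp
      rw [hf0 p hp', hf0 _ (by simpa using hp)]
      simp only [AddMonoidHom.prod_apply, AddMonoidHom.neg_apply, AddMonoidHom.coe_fst,
        AddMonoidHom.coe_snd, Prod.mk_sub_mk, Prod.snd_add, Prod.fst_add, add_sub_cancel_right]
      simp only [show -(p.1 + 1) - 1 = 0 ↔ p.1 = -2 by omega,
        show -(p.1 + 1) - 1 = -2 ↔ p.1 = 0 by omega]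
      split_ifs <;> simp)
  refine eq_endCount_of_recursion hS (f := f) (fun n p _ _ => hfrec n p) ?_ ?_ n p (by omega)
    (by omega)
  · intro p h1 h2
    rw [hf0 p h2, if_neg (show ¬ p.1 = -2 by omega), sub_zero]
    by_cases hp : p = 0
    · simp [hp]
    · rw [if_neg hp]
      split_ifs with h3 h4
      · exact absurd (Prod.ext h4 h3) hp
      · rfl
      · rfl
  · intro n p h1 h2 h3
    by_cases h4 : p.2 = -1
    · rw [show p = (p.1, -1) from Prod.ext rfl h4, hbot]
    · have h5 : p.1 = -1 := h3.resolve_right h4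
      have h := hside n p (by simp only [Set.mem_ofPred_eq]; omega)
      have h6 : ((-AddMonoidHom.fst ℤ ℤ).prod (AddMonoidHom.snd ℤ ℤ)) (p + (1, 1)) - (1, 1) = p := by
        ext <;> simp [h5]
      rw [h6] at h
      linarith

end

end QuadrantWalk

namespace QuadrantWalk

open Finset

noncomputable section

/-! ### Symmetric models -/

/-- The group of the model is finite, and the coefficients of
`xy O(x⁻¹, y⁻¹) S(x⁻¹, y⁻¹)^n` at the monomials of nonpositive exponents count the walks of
length `n`. -/
def OrbitSumCountsWalks (S : Finset (ℤ × ℤ)) : Prop :=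
  Finite (modelGroup S) ∧ ∀ n (i j : ℕ),
    invCoeff (i, j) (lx * ly * expand (orbitSum S) * stepPoly S lx⁻¹ ly⁻¹ ^ n) =
      endCount S n (i, j)

theorem mul_expand_orbitSum {X Y : RatXY} (hXY : IsCoordinates X Y) {z w : LaurentXY}
    (hz : z ≠ 0) (hw : w ≠ 0) (hX : expand X = z⁻¹) (hY : expand Y = w⁻¹)
    {T : Finset (ℤ × ℤ)} (h1 : ∃ s ∈ T, s.2 = 1) :
    z * w * expand ((X - X⁻¹) * (Y - Y⁻¹ * (coeffA T (-1) X / coeffA T 1 X))) * coeffA T 1 z⁻¹ =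
      (1 - z ^ 2) * (coeffA T 1 z⁻¹ - w ^ 2 * coeffA T (-1) z⁻¹) := by
  have hA : coeffA T 1 z⁻¹ ≠ 0 := by
    rw [← hX, ← expand_coeffA]
    exact (map_ne_zero expand).2 (hXY.coeffA_ne_zero h1)
  have h : expand ((X - X⁻¹) * (Y - Y⁻¹ * (coeffA T (-1) X / coeffA T 1 X))) =
      (z⁻¹ - z) * (w⁻¹ - w * (coeffA T (-1) z⁻¹ / coeffA T 1 z⁻¹)) := by
    rw [map_mul, map_sub, map_sub, map_mul, map_inv₀, map_inv₀, map_div₀, expand_coeffA,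
      expand_coeffA, hX, hY, show z⁻¹⁻¹ = z from inv_inv z, show w⁻¹⁻¹ = w from inv_inv w]
  rw [h]
  generalize coeffA T 1 z⁻¹ = a at hA ⊢
  generalize coeffA T (-1) z⁻¹ = d
  field_simp

/-! ### The two orders of reading coefficients, and the models symmetric in either axis -/

theorem isCoeffFamily_lx_ly : IsCoeffFamily lx ly fun k => HahnSeries.coeff.addMonoidHom (-k) where
  mul_monomial k F i j := by
    change (F * (lx⁻¹ ^ i * ly⁻¹ ^ j)).coeff (-k) = F.coeff (-(k - j)) * _
    rw [inv_zpow_mul_inv_zpow, show -k = -(k - j) + -j by ring, HahnSeries.coeff_mul_single_add]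
  one k := by
    change (1 : LaurentXY).coeff (-k) = _
    simp [HahnSeries.coeff_one]

/-- The coefficients of the powers of `x`, as Laurent series in `y`. -/
def coeffX (k : ℤ) : LaurentXY →+ LaurentSeries ℚ where
  toFun F := F.map (HahnSeries.coeff.addMonoidHom (R := ℚ) k)
  map_zero' := by ext; simp
  map_add' F G := by ext; simp

theorem coeff_coeffX (k j : ℤ) (F : LaurentXY) : (coeffX k F).coeff j = (F.coeff j).coeff k := rfl

/-- This lets the swapped models use the same expansion in ℚ((x))((y)), although that field treats x
and y differently. -/
theorem isCoeffFamily_ly_lx : IsCoeffFamily ly lx fun k => coeffX (-k) where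
  mul_monomial k F i j := by
    ext m
    have h1 : m = m + i + -i := by ring
    have h2 : -k = -(k - j) + -j := by ring
    have h3 : ((coeffX (-(k - j)) F) * (HahnSeries.single (-i) 1 : LaurentSeries ℚ)).coeff m =
        (coeffX (-(k - j)) F).coeff (m + i) := by
      conv_lhs => rw [h1]
      rw [HahnSeries.coeff_mul_single_add, mul_one]
    rw [h3, coeff_coeffX, coeff_coeffX, mul_comm (ly⁻¹ ^ i), inv_zpow_mul_inv_zpow]
    conv_lhs => rw [h1, h2]
    rw [HahnSeries.coeff_mul_single_add, HahnSeries.coeff_mul_single_add, mul_one]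
  one k := by
    ext m
    rw [coeff_coeffX, HahnSeries.coeff_one]
    by_cases hm : m = 0 <;> by_cases hk : k = 0 <;> simp [hm, hk, HahnSeries.coeff_one]

/-- Symmetry turns Ψ into x ↦ x⁻¹. -/
theorem coeffB_div_eq_one {S : Finset (ℤ × ℤ)} (hsym : IsVerticallySymmetric S)
    (h3 : ∃ s ∈ S, s.1 = 1) {X Y : RatXY} (hXY : IsCoordinates X Y) :
    coeffB S (-1) X / coeffB S 1 X = 1 := by
  rw [hsym.coeffB_neg, div_self]
  rw [coeffB_eq_coeffA_image_swap]
  obtain ⟨s, hs, h⟩ := h3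
  exact hXY.coeffA_ne_zero ⟨s.swap, mem_image_of_mem _ hs, h⟩

theorem orbitSumCountsWalks_of_vertical {S : Finset (ℤ × ℤ)} (hS : IsSmall S)
    (hsym : IsVerticallySymmetric S) (h1 : ∃ s ∈ S, s.2 = 1) (h2 : ∃ s ∈ S, s.2 = -1)
    (h3 : ∃ s ∈ S, s.1 = 1) : OrbitSumCountsWalks S := by
  obtain ⟨hfin, hO⟩ := isCoordinates_rx_ry.orbitSum_eq hsym h1 h2 (S := S) fun σ => by
    rw [generators, Set.mem_ofPred_eq, IsPhi, IsPsi,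
      coeffB_div_eq_one hsym h3 isCoordinates_ry_rx, mul_one]
  refine ⟨hfin, fun n i j => ?_⟩
  refine isCoeffFamily_lx_ly.eq_endCount hS hsym h1 h2 ?_ n (i, j) (by simp) (by simp)
  rw [hO]
  exact mul_expand_orbitSum isCoordinates_rx_ry lx_ne_zero ly_ne_zero expand_rx expand_ry h1

theorem image_swap_image_swap (S : Finset (ℤ × ℤ)) :
    (S.image Prod.swap).image Prod.swap = S := by
  rw [image_image, Prod.swap_swap_eq, image_id]

theorem orbitSumCountsWalks_image_swap {T : Finset (ℤ × ℤ)} (hT : IsSmall T)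
    (hsym : IsVerticallySymmetric T) (h1 : ∃ s ∈ T, s.2 = 1) (h2 : ∃ s ∈ T, s.2 = -1)
    (h3 : ∃ s ∈ T, s.1 = 1) : OrbitSumCountsWalks (T.image Prod.swap) := by
  have hA : ∀ k, coeffA (T.image Prod.swap) k rx = coeffB T k rx := fun k =>
    (coeffB_eq_coeffA_image_swap T k rx).symm
  have hB : ∀ k, coeffB (T.image Prod.swap) k ry = coeffA T k ry := fun k => by
    rw [coeffB_eq_coeffA_image_swap, image_swap_image_swap]
  obtain ⟨hfin, hO⟩ := isCoordinates_ry_rx.orbitSum_eq hsym h1 h2 (S := T.image Prod.swap)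
    fun σ => by
      rw [generators, Set.mem_ofPred_eq, IsPhi, IsPsi, hA, hA, hB, hB,
        coeffB_div_eq_one hsym h3 isCoordinates_rx_ry, mul_one]
      tauto
  refine ⟨hfin, fun n i j => ?_⟩
  have h := isCoeffFamily_ly_lx.eq_endCount hT hsym h1 h2
    (F := ly * lx * expand (orbitSum (T.image Prod.swap))) ?_ n (j, i) (by simp) (by simp)
  · rw [← stepPoly_image_swap T, mul_comm ly lx] at h
    rw [show ((i : ℤ), (j : ℤ)) = Prod.swap ((j : ℤ), (i : ℤ)) from rfl, endCount_image_swap hT]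
    exact h
  · rw [hO]
    exact mul_expand_orbitSum isCoordinates_ry_rx ly_ne_zero lx_ne_zero expand_ry expand_rx h1

/-! ### Models whose group acts on monomials -/

/-- The action of `(x, y) ↦ (x, x^k y⁻¹)` on the exponents of monomials. -/
def shearX (k : ℤ) : ℤ × ℤ →+ ℤ × ℤ where
  toFun p := (p.1 + k * p.2, -p.2)
  map_zero' := by simp
  map_add' p q := by ext <;> simp <;> ring

/-- The action of `(x, y) ↦ (x⁻¹ y^l, y)` on the exponents of monomials. -/
def shearY (l : ℤ) : ℤ × ℤ →+ ℤ × ℤ where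
  toFun p := (-p.1, p.2 + l * p.1)
  map_zero' := by simp
  map_add' p q := by ext <;> simp <;> ring

theorem shearX_shearX (k : ℤ) (p : ℤ × ℤ) : shearX k (shearX k p) = p := by
  ext <;> simp [shearX]

theorem shearY_shearY (l : ℤ) (p : ℤ × ℤ) : shearY l (shearY l p) = p := by
  ext <;> simp [shearY]

/-- The monomial `x^i y^j`. -/
def mono (p : ℤ × ℤ) : RatXY := rx ^ p.1 * ry ^ p.2

theorem mono_injective : Function.Injective mono := fun _ _ h =>
  Prod.ext (monomial_injective h).1 (monomial_injective h).2

theorem mono_one_one : mono (1, 1) = rx * ry := by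
  simp [mono]

theorem mul_inv_zpow_mul_inv_zpow {F : Type*} [Field F] {u v : F} (hu : u ≠ 0) (hv : v ≠ 0)
    (i j : ℤ) : u * v * (u⁻¹ ^ i * v⁻¹ ^ j) = u⁻¹ ^ (i - 1) * v⁻¹ ^ (j - 1) := by
  rw [zpow_sub_one₀ (inv_ne_zero hu), zpow_sub_one₀ (inv_ne_zero hv), inv_inv, inv_inv]
  ring

theorem invCoeff_expand_mono (p q : ℤ × ℤ) :
    invCoeff p (lx * ly * expand (mono q)) = if q = p + (1, 1) then 1 else 0 := by
  have h : lx * ly * expand (mono q) = lx⁻¹ ^ (q.1 - 1) * ly⁻¹ ^ (q.2 - 1) := by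
    rw [mono, map_mul, map_zpow₀, map_zpow₀, expand_rx, expand_ry]
    exact mul_inv_zpow_mul_inv_zpow (F := LaurentXY) lx_ne_zero ly_ne_zero _ _
  rw [h, invCoeff_monomial]
  congr 1
  rw [eq_iff_iff, Prod.ext_iff, Prod.ext_iff]
  simp only [Prod.fst_add, Prod.snd_add]
  omega

theorem exists_monomial_generators {S : Finset (ℤ × ℤ)} {k l : ℤ}
    (hA1 : ∃ s ∈ S, s.2 = 1) (hB1 : ∃ s ∈ S, s.1 = 1)
    (hA : coeffA S (-1) rx = rx ^ k * coeffA S 1 rx)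
    (hB : coeffB S (-1) ry = ry ^ l * coeffB S 1 ry) :
    ∃ σ τ : Birational, generators S = {σ, τ} ∧ (∀ p, σ (mono p) = mono (shearX k p)) ∧
      ∀ p, τ (mono p) = mono (shearY l p) := by
  have hA' : coeffA S (-1) rx / coeffA S 1 rx = rx ^ k :=
    (div_eq_iff (isCoordinates_rx_ry.coeffA_ne_zero hA1)).2 hA
  have hB' : coeffB S (-1) ry / coeffB S 1 ry = ry ^ l := by
    refine (div_eq_iff ?_).2 hB
    rw [coeffB_eq_coeffA_image_swap]
    obtain ⟨s, hs, h⟩ := hB1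
    exact isCoordinates_ry_rx.coeffA_ne_zero ⟨s.swap, mem_image_of_mem _ hs, h⟩
  have hx := rx_ne_zero
  have hy := ry_ne_zero
  obtain ⟨σ, hσx, hσy⟩ := exists_birational (u := rx) (v := ry⁻¹ * rx ^ k) fun L h1 h2 => by
    refine ⟨h1, ?_⟩
    rw [show ry = rx ^ k * (ry⁻¹ * rx ^ k)⁻¹ by field_simp]
    exact mul_mem (zpow_mem h1 k) (inv_mem h2)
  obtain ⟨τ, hτx, hτy⟩ := exists_birational (u := rx⁻¹ * ry ^ l) (v := ry) fun L h1 h2 => by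
    refine ⟨?_, h2⟩
    rw [show rx = ry ^ l * (rx⁻¹ * ry ^ l)⁻¹ by field_simp]
    exact mul_mem (zpow_mem h2 l) (inv_mem h1)
  refine ⟨σ, τ, ?_, fun p => ?_, fun p => ?_⟩
  · ext g
    rw [generators, Set.mem_ofPred_eq, IsPhi, IsPsi, hA', hB', Set.mem_insert_iff,
      Set.mem_singleton_iff]
    constructor
    · rintro (⟨h1, h2⟩ | ⟨h1, h2⟩)
      · exact Or.inl (birational_ext (h1.trans hσx.symm) (h2.trans hσy.symm))
      · exact Or.inr (birational_ext (h1.trans hτx.symm) (h2.trans hτy.symm))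
    · rintro (rfl | rfl)
      · exact Or.inl ⟨hσx, hσy⟩
      · exact Or.inr ⟨hτx, hτy⟩
  · change σ (rx ^ p.1 * ry ^ p.2) = rx ^ (p.1 + k * p.2) * ry ^ (-p.2)
    rw [map_mul, map_zpow₀, map_zpow₀, hσx, hσy, mul_zpow, inv_zpow', ← zpow_mul, zpow_add₀ hx]
    ring
  · change τ (rx ^ p.1 * ry ^ p.2) = rx ^ (-p.1) * ry ^ (p.2 + l * p.1)
    rw [map_mul, map_zpow₀, map_zpow₀, hτx, hτy, mul_zpow, inv_zpow', ← zpow_mul, zpow_add₀ hy]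
    ring

theorem birational_ext_mono {σ τ : Birational} (h : ∀ p, σ (mono p) = τ (mono p)) : σ = τ := by
  refine birational_ext ?_ ?_
  · simpa [mono] using h (1, 0)
  · simpa [mono] using h (0, 1)

/-- The group and the orbit sum of a model whose group acts on monomials. -/
theorem orbitSum_of_monomial {S : Finset (ℤ × ℤ)} {k l : ℤ}
    (hA1 : ∃ s ∈ S, s.2 = 1) (hB1 : ∃ s ∈ S, s.1 = 1)
    (hA : coeffA S (-1) rx = rx ^ k * coeffA S 1 rx)
    (hB : coeffB S (-1) ry = ry ^ l * coeffB S 1 ry) {m : ℕ} (hm : 0 < m)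
    (hid : ∀ p, (fun q => shearX k (shearY l q))^[m] p = p)
    (hne : ∀ i < m, 0 < i → (fun q => shearX k (shearY l q))^[i] (1, 1) ≠ (1, 1)) :
    Finite (modelGroup S) ∧ orbitSum S = ∑ i ∈ range m,
      (mono ((fun q => shearX k (shearY l q))^[i] (1, 1)) -
        mono ((fun q => shearX k (shearY l q))^[i] (shearX k (1, 1)))) := by
  obtain ⟨σ, τ, hgen, hσ, hτ⟩ := exists_monomial_generators hA1 hB1 hA hB
  have hpow : ∀ i p, ((σ * τ) ^ i) (mono p) = mono ((fun q => shearX k (shearY l q))^[i] p) := by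
    intro i
    induction i with
    | zero => intro p; rfl
    | succ i ih =>
      intro p
      rw [pow_succ, AlgEquiv.mul_apply, AlgEquiv.mul_apply, hτ, hσ, ih, Function.iterate_succ_apply]
  have hσσ : σ * σ = 1 := birational_ext_mono fun p => by
    rw [AlgEquiv.mul_apply, hσ, hσ, shearX_shearX, AlgEquiv.one_apply]
  have hττ : τ * τ = 1 := birational_ext_mono fun p => by
    rw [AlgEquiv.mul_apply, hτ, hτ, shearY_shearY, AlgEquiv.one_apply]
  have hσ1 : σ ≠ 1 := by
    rintro rfl
    have := congrArg Prod.snd (mono_injective (hσ (0, 1)))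
    simp [shearX] at this
  have hτ1 : τ ≠ 1 := by
    rintro rfl
    have := congrArg Prod.fst (mono_injective (hτ (1, 0)))
    simp [shearY] at this
  -- That no smaller power is trivial is tested on the single monomial xy.
  have hord : orderOf (σ * τ) = m := by
    rw [orderOf_eq_iff hm]
    refine ⟨birational_ext_mono fun p => ?_, fun i hi hi0 h => hne i hi hi0 ?_⟩
    · rw [hpow, hid, AlgEquiv.one_apply]
    · apply mono_injective
      rw [← hpow, h, AlgEquiv.one_apply]
  obtain ⟨hfin, hO⟩ := orbitSum_of_involutions hgen hσσ hττ hσ1 hτ1 m hm hord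
  refine ⟨hfin, hO.trans (sum_congr rfl fun i _ => ?_)⟩
  rw [← mono_one_one, AlgEquiv.mul_apply, hσ, hpow, hpow]

/-- `Q` and `Q'` hold the exponents of positive and negative sign in the orbit of xy. The shears
exchange them and preserve the steps, and only (1, 1) lies in the open quadrant; the factor xy moves
it to the origin. -/
theorem orbitSumCountsWalks_of_monomial {S : Finset (ℤ × ℤ)} (hS : IsSmall S) {k l : ℤ}
    (hfin : Finite (modelGroup S)) (hkS : ∀ s ∈ S, shearX k s ∈ S) (hlS : ∀ s ∈ S, shearY l s ∈ S)
    {Q Q' : Finset (ℤ × ℤ)} (hO : orbitSum S = ∑ q ∈ Q, mono q - ∑ q ∈ Q', mono q)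
    (hk : ∀ q ∈ Q, shearX k q ∈ Q') (hk' : ∀ q ∈ Q', shearX k q ∈ Q)
    (hl : ∀ q ∈ Q, shearY l q ∈ Q') (hl' : ∀ q ∈ Q', shearY l q ∈ Q) (h11 : (1, 1) ∈ Q)
    (hQ : ∀ q ∈ Q, 0 < q.1 → 0 < q.2 → q = (1, 1)) (hQ' : ∀ q ∈ Q', 0 < q.1 → ¬ 0 < q.2) :
    OrbitSumCountsWalks S := by
  refine ⟨hfin, fun n i j => ?_⟩
  set f : ℕ → ℤ × ℤ → ℚ := fun n p =>
    invCoeff p (lx * ly * expand (orbitSum S) * stepPoly S lx⁻¹ ly⁻¹ ^ n) with hf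
  have hrec : ∀ n p, f (n + 1) p = ∑ s ∈ S, f n (p - s) := by
    intro n p
    simp only [hf]
    rw [pow_succ, ← mul_assoc, invCoeff_mul_stepPoly]
  have hf0 : ∀ p, f 0 p = (if p + (1, 1) ∈ Q then 1 else 0) - if p + (1, 1) ∈ Q' then 1 else 0 := by
    intro p
    simp only [hf]
    rw [pow_zero, mul_one, hO, map_sub, map_sum, map_sum, mul_sub, mul_sum, mul_sum, map_sub,
      map_sum, map_sum]
    simp only [invCoeff_expand_mono, sum_ite_eq']
  -- At a fixed point of the shifted reflection the coefficient equals its own negative. For the two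
  -- shears these points include the lines p.2 = -1 and p.1 = -1.
  have hanti : ∀ ρ : ℤ × ℤ →+ ℤ × ℤ, (∀ p, ρ (ρ p) = p) → (∀ s ∈ S, ρ s ∈ S) →
      (∀ q ∈ Q, ρ q ∈ Q') → (∀ q ∈ Q', ρ q ∈ Q) → ∀ n p, ρ (p + (1, 1)) = p + (1, 1) →
        f n p = 0 := by
    intro ρ hρ hρS h1 h2 n p hp
    have h := antisymm_of_recursion Set.univ ρ hρ hρS hrec (fun _ _ _ _ h => absurd trivial h)
      (fun p _ => by
        have e1 : ρ (p + (1, 1)) ∈ Q ↔ p + (1, 1) ∈ Q' :=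
          ⟨fun h => hρ (p + (1, 1)) ▸ h1 _ h, h2 _⟩
        have e2 : ρ (p + (1, 1)) ∈ Q' ↔ p + (1, 1) ∈ Q :=
          ⟨fun h => hρ (p + (1, 1)) ▸ h2 _ h, h1 _⟩
        rw [hf0, hf0, sub_add_cancel]
        simp only [e1, e2]
        ring) n p trivial
    rw [hp, add_sub_cancel_right] at h
    linarith
  refine eq_endCount_of_recursion hS (f := f) (fun n p _ _ => hrec n p) ?_ ?_ n (i, j)
    (by simp only; omega) (by simp only; omega)
  · intro p h1 h2
    have h1' : 0 < (p + (1, 1)).1 := by rw [Prod.fst_add]; omega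
    have h2' : 0 < (p + (1, 1)).2 := by rw [Prod.snd_add]; omega
    rw [hf0, if_neg fun h => hQ' _ h h1' h2', sub_zero]
    refine if_congr ⟨fun h => ?_, ?_⟩ rfl rfl
    · simpa using hQ _ h h1' h2'
    · rintro rfl
      simpa using h11
  · intro n p _ _ h3
    rcases h3 with h3 | h3
    · refine hanti (shearY l) (shearY_shearY l) hlS hl hl' n p ?_
      ext <;> simp [shearY, h3]
    · refine hanti (shearX k) (shearX_shearX k) hkS hk hk' n p ?_
      ext <;> simp [shearX, h3]

end

end QuadrantWalk

namespace QuadrantWalk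

open Finset

/-! ### The nineteen models -/

/-- The shears with k = l = 1 generate a dihedral group of order 6; `Q` and `Q'` list its orbit of
(1, 1). -/
theorem orbitSumCountsWalks_of_three {S : Finset (ℤ × ℤ)} (hS : IsSmall S)
    (hA1 : ∃ s ∈ S, s.2 = 1) (hB1 : ∃ s ∈ S, s.1 = 1)
    (hA : coeffA S (-1) rx = rx ^ (1 : ℤ) * coeffA S 1 rx)
    (hB : coeffB S (-1) ry = ry ^ (1 : ℤ) * coeffB S 1 ry)
    (hkS : ∀ s ∈ S, shearX 1 s ∈ S) (hlS : ∀ s ∈ S, shearY 1 s ∈ S) : OrbitSumCountsWalks S := by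
  obtain ⟨hfin, hO⟩ := orbitSum_of_monomial (m := 3) hA1 hB1 hA hB (by norm_num)
    (fun p => by ext <;> simp [shearX, shearY]) (by decide)
  refine orbitSumCountsWalks_of_monomial hS hfin hkS hlS
    (Q := {(1, 1), (1, -2), (-2, 1)}) (Q' := {(2, -1), (-1, -1), (-1, 2)}) ?_ (by decide)
    (by decide) (by decide) (by decide) (by decide) (by decide) (by decide)
  rw [hO, sum_sub_distrib, sum_range_succ, sum_range_succ, sum_range_one, sum_range_succ,
    sum_range_succ, sum_range_one, sum_insert (by decide), sum_pair (by decide),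
    sum_insert (by decide), sum_pair (by decide), ← add_assoc, ← add_assoc]
  rfl

/-- With k = 2 and l = 1 the group is dihedral of order 8. The exchange of coordinates exchanges k
and l, so the swapped model needs its own orbit. -/
theorem orbitSumCountsWalks_of_four {S : Finset (ℤ × ℤ)} (hS : IsSmall S)
    (hA1 : ∃ s ∈ S, s.2 = 1) (hB1 : ∃ s ∈ S, s.1 = 1)
    (hA : coeffA S (-1) rx = rx ^ (2 : ℤ) * coeffA S 1 rx)
    (hB : coeffB S (-1) ry = ry ^ (1 : ℤ) * coeffB S 1 ry)
    (hkS : ∀ s ∈ S, shearX 2 s ∈ S) (hlS : ∀ s ∈ S, shearY 1 s ∈ S) : OrbitSumCountsWalks S := by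
  obtain ⟨hfin, hO⟩ := orbitSum_of_monomial (m := 4) hA1 hB1 hA hB (by norm_num)
    (fun p => by ext <;> simp [shearX, shearY] <;> ring) (by decide)
  refine orbitSumCountsWalks_of_monomial hS hfin hkS hlS
    (Q := {(1, 1), (3, -2), (-1, -1), (-3, 2)}) (Q' := {(3, -1), (1, -2), (-3, 1), (-1, 2)}) ?_
    (by decide) (by decide) (by decide) (by decide) (by decide) (by decide) (by decide)
  rw [hO, sum_sub_distrib, sum_range_succ, sum_range_succ, sum_range_succ, sum_range_one,
    sum_range_succ, sum_range_succ, sum_range_succ, sum_range_one, sum_insert (by decide),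
    sum_insert (by decide), sum_pair (by decide), sum_insert (by decide), sum_insert (by decide),
    sum_pair (by decide), ← add_assoc, ← add_assoc, ← add_assoc, ← add_assoc]
  rfl

theorem orbitSumCountsWalks_of_four_swap {S : Finset (ℤ × ℤ)} (hS : IsSmall S)
    (hA1 : ∃ s ∈ S, s.2 = 1) (hB1 : ∃ s ∈ S, s.1 = 1)
    (hA : coeffA S (-1) rx = rx ^ (1 : ℤ) * coeffA S 1 rx)
    (hB : coeffB S (-1) ry = ry ^ (2 : ℤ) * coeffB S 1 ry)
    (hkS : ∀ s ∈ S, shearX 1 s ∈ S) (hlS : ∀ s ∈ S, shearY 2 s ∈ S) : OrbitSumCountsWalks S := by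
  obtain ⟨hfin, hO⟩ := orbitSum_of_monomial (m := 4) hA1 hB1 hA hB (by norm_num)
    (fun p => by ext <;> simp [shearX, shearY] <;> ring) (by decide)
  refine orbitSumCountsWalks_of_monomial hS hfin hkS hlS
    (Q := {(1, 1), (2, -3), (-1, -1), (-2, 3)}) (Q' := {(2, -1), (1, -3), (-2, 1), (-1, 3)}) ?_
    (by decide) (by decide) (by decide) (by decide) (by decide) (by decide) (by decide)
  rw [hO, sum_sub_distrib, sum_range_succ, sum_range_succ, sum_range_succ, sum_range_one,
    sum_range_succ, sum_range_succ, sum_range_succ, sum_range_one, sum_insert (by decide),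
    sum_insert (by decide), sum_pair (by decide), sum_insert (by decide), sum_insert (by decide),
    sum_pair (by decide), ← add_assoc, ← add_assoc, ← add_assoc, ← add_assoc]
  rfl

/-! ### Sorting the models into symmetric and sporadic ones, and checking the latter -/

instance (S : Finset (ℤ × ℤ)) : Decidable (IsSmall S) := by
  unfold IsSmall
  infer_instance

instance (S : Finset (ℤ × ℤ)) : Decidable (IsVerticallySymmetric S) := by
  unfold IsVerticallySymmetric
  infer_instance

theorem mem_nonalgebraicModels {S : Finset (ℤ × ℤ)} (hS : S ∈ nonalgebraicModels) :
    IsSmall S ∧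
      ((IsVerticallySymmetric S ∧ (∃ s ∈ S, s.2 = 1) ∧ (∃ s ∈ S, s.2 = -1) ∧ ∃ s ∈ S, s.1 = 1) ∨
        S = {stepN, stepW, stepSE} ∨ S = {stepNW, stepSE, stepN, stepS, stepE, stepW} ∨
        S = {stepE, stepSE, stepW, stepNW}) := by
  revert S
  decide

theorem coeffA_eq_of_filter_eq {S T : Finset (ℤ × ℤ)} {k : ℤ} (h : {p ∈ S | p.2 = k} = T)
    {F : Type*} [Field F] (u : F) : coeffA S k u = ∑ p ∈ T, u ^ p.1 := by
  rw [coeffA, h]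

theorem coeffB_eq_of_filter_eq {S T : Finset (ℤ × ℤ)} {k : ℤ} (h : {p ∈ S | p.1 = k} = T)
    {F : Type*} [Field F] (v : F) : coeffB S k v = ∑ p ∈ T, v ^ p.2 := by
  rw [coeffB, h]

theorem orbitSumCountsWalks_tandem : OrbitSumCountsWalks {stepN, stepW, stepSE} := by
  refine orbitSumCountsWalks_of_three (by decide) (by decide) (by decide) ?_ ?_ (by decide)
    (by decide)
  · rw [coeffA_eq_of_filter_eq (T := {(1, -1)}) (by decide),
      coeffA_eq_of_filter_eq (T := {(0, 1)}) (by decide)]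
    simp
  · have := ry_ne_zero
    rw [coeffB_eq_of_filter_eq (T := {(-1, 0)}) (by decide),
      coeffB_eq_of_filter_eq (T := {(1, -1)}) (by decide)]
    simp [this]

theorem orbitSumCountsWalks_tandem_swap :
    OrbitSumCountsWalks (image Prod.swap {stepN, stepW, stepSE}) := by
  refine orbitSumCountsWalks_of_three (by decide) (by decide) (by decide) ?_ ?_ (by decide)
    (by decide)
  · have := rx_ne_zero
    rw [coeffA_eq_of_filter_eq (T := {(0, -1)}) (by decide),
      coeffA_eq_of_filter_eq (T := {(-1, 1)}) (by decide)]
    simp [this]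
  · rw [coeffB_eq_of_filter_eq (T := {(-1, 1)}) (by decide),
      coeffB_eq_of_filter_eq (T := {(1, 0)}) (by decide)]
    simp

theorem orbitSumCountsWalks_double_tandem :
    OrbitSumCountsWalks {stepNW, stepSE, stepN, stepS, stepE, stepW} := by
  refine orbitSumCountsWalks_of_three (by decide) (by decide) (by decide) ?_ ?_ (by decide)
    (by decide)
  · have := rx_ne_zero
    rw [coeffA_eq_of_filter_eq (T := {(1, -1), (0, -1)}) (by decide),
      coeffA_eq_of_filter_eq (T := {(0, 1), (-1, 1)}) (by decide), sum_pair (by decide),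
      sum_pair (by decide)]
    simp [mul_add, this]
  · have := ry_ne_zero
    rw [coeffB_eq_of_filter_eq (T := {(-1, 1), (-1, 0)}) (by decide),
      coeffB_eq_of_filter_eq (T := {(1, 0), (1, -1)}) (by decide), sum_pair (by decide),
      sum_pair (by decide)]
    simp [mul_add, this]

theorem orbitSumCountsWalks_gouyouBeauchamps :
    OrbitSumCountsWalks {stepE, stepSE, stepW, stepNW} := by
  refine orbitSumCountsWalks_of_four (by decide) (by decide) (by decide) ?_ ?_ (by decide)
    (by decide)
  · have := rx_ne_zero
    rw [coeffA_eq_of_filter_eq (T := {(1, -1)}) (by decide),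
      coeffA_eq_of_filter_eq (T := {(-1, 1)}) (by decide), sum_singleton, sum_singleton,
      ← zpow_add₀ this]
    rfl
  · have := ry_ne_zero
    rw [coeffB_eq_of_filter_eq (T := {(-1, 1), (-1, 0)}) (by decide),
      coeffB_eq_of_filter_eq (T := {(1, 0), (1, -1)}) (by decide), sum_pair (by decide),
      sum_pair (by decide)]
    simp [mul_add, this]

theorem orbitSumCountsWalks_gouyouBeauchamps_swap :
    OrbitSumCountsWalks (image Prod.swap {stepE, stepSE, stepW, stepNW}) := by
  refine orbitSumCountsWalks_of_four_swap (by decide) (by decide) (by decide) ?_ ?_ (by decide)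
    (by decide)
  · have := rx_ne_zero
    rw [coeffA_eq_of_filter_eq (T := {(1, -1), (0, -1)}) (by decide),
      coeffA_eq_of_filter_eq (T := {(0, 1), (-1, 1)}) (by decide), sum_pair (by decide),
      sum_pair (by decide)]
    simp [mul_add, this]
  · have := ry_ne_zero
    rw [coeffB_eq_of_filter_eq (T := {(-1, 1)}) (by decide),
      coeffB_eq_of_filter_eq (T := {(1, -1)}) (by decide), sum_singleton, sum_singleton,
      ← zpow_add₀ this]
    rfl

theorem orbitSumCountsWalks_of_mem {S : Finset (ℤ × ℤ)} (hS : S ∈ nonalgebraicModels) :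
    IsSmall S ∧ OrbitSumCountsWalks S ∧ OrbitSumCountsWalks (S.image Prod.swap) := by
  obtain ⟨hsm, ⟨hsym, h1, h2, h3⟩ | rfl | rfl | rfl⟩ := mem_nonalgebraicModels hS
  · exact ⟨hsm, orbitSumCountsWalks_of_vertical hsm hsym h1 h2 h3,
      orbitSumCountsWalks_image_swap hsm hsym h1 h2 h3⟩
  · exact ⟨hsm, orbitSumCountsWalks_tandem, orbitSumCountsWalks_tandem_swap⟩
  · refine ⟨hsm, orbitSumCountsWalks_double_tandem, ?_⟩
    -- This step set is its own mirror image in the main diagonal.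
    rw [show image Prod.swap {stepNW, stepSE, stepN, stepS, stepE, stepW} =
      ({stepNW, stepSE, stepN, stepS, stepE, stepW} : Finset (ℤ × ℤ)) by decide]
    exact orbitSumCountsWalks_double_tandem
  · exact ⟨hsm, orbitSumCountsWalks_gouyouBeauchamps, orbitSumCountsWalks_gouyouBeauchamps_swap⟩

end QuadrantWalk

theorem theorem2 (S : Finset (ℤ × ℤ))
    (hS : S ∈ QuadrantWalk.nonalgebraicModels ∨
      S.image Prod.swap ∈ QuadrantWalk.nonalgebraicModels)
    (a b : ℕ) (ha : a ∈ ({0, 1} : Set ℕ)) (hb : b ∈ ({0, 1} : Set ℕ)) :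
    Finite (QuadrantWalk.modelGroup S) ∧
      QuadrantWalk.walkGFAt S (a : ℚ) (b : ℚ) =
        QuadrantWalk.diagonal (QuadrantWalk.diagonand S a b) := by
  have h : QuadrantWalk.IsSmall S ∧ QuadrantWalk.OrbitSumCountsWalks S := by
    rcases hS with hS | hS
    · obtain ⟨h1, h2, -⟩ := QuadrantWalk.orbitSumCountsWalks_of_mem hS
      exact ⟨h1, h2⟩
    · obtain ⟨h1, -, h2⟩ := QuadrantWalk.orbitSumCountsWalks_of_mem hS
      have h1 := h1.image_swap
      rw [QuadrantWalk.image_swap_image_swap] at h1 h2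
      exact ⟨h1, h2⟩
  exact ⟨h.2.1, QuadrantWalk.walkGFAt_eq_diagonal h.1 h.2.2 ha hb⟩
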